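/- Let $q\in\mathbb{C}$ be a root of unity, $q^{2l}=1$ for some $l\ge 1$, and put $\delta=q+q^{-1}$. Let $TL_n=TL_n(\delta)$ be the Temperley--Lieb algebra, i.e. the unital $\mathbb{C}$-algebra with generators $e_1,\dots,e_{n-1}$ and relations $e_i^2=\delta e_i$, $e_ie_{i\pm1}e_i=e_i$, and $e_ie_j=e_je_i$ for $|i-j|>1$. A trace on an algebra $A$ is a linear map $t:A\to\mathbb{C}$ with $t(ab)=t(ba)$. Let $J(TL_n)$ be the Jacobson radical and $TL_n^S=TL_n/J(TL_n)$. A matrix trace on $TL_n^S$ is a functional $x\mapsto \mathrm{tr}(\rho(x))$ with $\rho:TL_n^S\to M_d(\mathbb{C})$, $d\ge1$, a surjective algebra homomorphism; matrix traces on $TL_n^S$ are regarded as functionals on $TL_n$. 1. For every $n\ge 0$, the space of traces on $TL_n$ has dimension $\lfloor n/2\rfloor+1$. 2. If $\delta\neq0$ or $n$ is odd, every trace on $TL_n$ vanishes on $J(TL_n)$, and the matrix traces on $TL_n^S$ form a basis of the space of traces on $TL_n$. 3. If $\delta=0$ and $n\ge1$, there are exactly $n$ distinct matrix traces on $TL_{2n}^S$,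 and there is an extra trace $t^0_{2n,n}$ on $TL_{2n}$ (not necessarily unique) with $$t^0_{2n,n}\big((e_1e_3\cdots e_{2n-1})(e_2e_4\cdots e_{2n-2})\big)=1$$ (for $n=1$ this reads $t^0_{2,1}(e_1)=1$). For every trace $t^0_{2n,n}$ with this normalization, the $n$ matrix traces on $TL_{2n}^S$ together with $t^0_{2n,n}$ form a basis of the space of traces on $TL_{2n}$. -/

import Mathlib

noncomputable section

namespace TemperleyLieb

/-- The defining relations of the Temperley-Lieb algebra `TL_n(δ)`. The generator `e_{i+1}` of the
usual numbering `e_1, …, e_{n-1}` is the free variable with index `i : Fin (n - 1)`. -/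
inductive Rel (n : ℕ) (δ : ℂ) :
    FreeAlgebra ℂ (Fin (n - 1)) → FreeAlgebra ℂ (Fin (n - 1)) → Prop
  | sq (i : Fin (n - 1)) :
      Rel n δ (FreeAlgebra.ι ℂ i * FreeAlgebra.ι ℂ i) (δ • FreeAlgebra.ι ℂ i)
  | adj (i j : Fin (n - 1)) (h : i.val + 1 = j.val ∨ j.val + 1 = i.val) :
      Rel n δ (FreeAlgebra.ι ℂ i * FreeAlgebra.ι ℂ j * FreeAlgebra.ι ℂ i) (FreeAlgebra.ι ℂ i)
  | comm (i j : Fin (n - 1)) (h : i.val + 1 < j.val ∨ j.val + 1 < i.val) :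
      Rel n δ (FreeAlgebra.ι ℂ i * FreeAlgebra.ι ℂ j) (FreeAlgebra.ι ℂ j * FreeAlgebra.ι ℂ i)

/-- The Temperley-Lieb algebra `TL_n(δ)`: the unital complex algebra with generators
`e_1, …, e_{n-1}` and relations `e_i² = δ e_i`, `e_i e_{i±1} e_i = e_i` and
`e_i e_j = e_j e_i` for `|i - j| > 1`. -/
abbrev TL (n : ℕ) (δ : ℂ) : Type := RingQuot (Rel n δ)

/-- The generator `e_{i+1}` of `TL_n(δ)`. -/
def gen (n : ℕ) (δ : ℂ) (i : Fin (n - 1)) : TL n δ :=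
  RingQuot.mkAlgHom ℂ (Rel n δ) (FreeAlgebra.ι ℂ i)

/-- The product `(e_1 e_3 ⋯ e_{2m-1}) (e_2 e_4 ⋯ e_{2m-2})` in `TL_{2m}(δ)`
(for `m = 1` it is `e_1`). -/
def oddEvenWord (m : ℕ) (δ : ℂ) : TL (2 * m) δ :=
  (List.ofFn fun i : Fin m => gen (2 * m) δ ⟨2 * i.val, by omega⟩).prod *
    (List.ofFn fun i : Fin (m - 1) => gen (2 * m) δ ⟨2 * i.val + 1, by omega⟩).prod

/-- The space of traces on a complex algebra: the linear functionals with `t (ab) = t (ba)`. -/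
def traceSpace (A : Type*) [Ring A] [Algebra ℂ A] : Submodule ℂ (A →ₗ[ℂ] ℂ) where
  carrier := {t | ∀ a b : A, t (a * b) = t (b * a)}
  add_mem' := by
    intro s t hs ht a b
    simp [hs a b, ht a b]
  zero_mem' := by
    intro a b
    simp
  smul_mem' := by
    intro c t ht a b
    simp [ht a b]

/-- The maximal semisimple quotient `A^S = A / J(A)`, with `J(A)` the Jacobson radical. -/
abbrev Semisimplification (A : Type*) [Ring A] : Type _ := A ⧸ Ring.jacobson A

/-- The matrix traces on a complex algebra `B`: the functionals `b ↦ tr (ρ b)` with `ρ` a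
surjective algebra homomorphism from `B` onto a full matrix algebra `M_d(ℂ)`, `d ≥ 1`. If `B` is
finite-dimensional and semisimple these are the traces on the factors of `B ≃ ∏ M_{d_i}(ℂ)`. -/
def matrixTraces (B : Type*) [Ring B] [Algebra ℂ B] : Set (B →ₗ[ℂ] ℂ) :=
  {t | ∃ (d : ℕ) (ρ : B →ₐ[ℂ] Matrix (Fin d) (Fin d) ℂ), 0 < d ∧ Function.Surjective ρ ∧
    t = (Matrix.traceLinearMap (Fin d) ℂ ℂ).comp ρ.toLinearMap}

/-- The matrix traces on `A^S = A / J(A)`, regarded as functionals on `A`. -/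
def semisimpleMatrixTraces (A : Type*) [Ring A] [Algebra ℂ A] : Set (A →ₗ[ℂ] ℂ) :=
  (fun t => t.comp (Ideal.Quotient.mkₐ ℂ (Ring.jacobson A)).toLinearMap) ''
    matrixTraces (Semisimplification A)

/-- `S` is a basis of the subspace `W`. -/
def IsBasisOf {V : Type*} [AddCommGroup V] [Module ℂ V] (S : Set V) (W : Submodule ℂ V) : Prop :=
  LinearIndepOn ℂ id S ∧ Submodule.span ℂ S = W

end TemperleyLieb

end

namespace TemperleyLieb

/-! All traces are compared through their values on the test elements e_1⋯e_{2j}, 0 ≤ j ≤ ⌊n/2⌋,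
where for 2j = n the product of all generators e_1⋯e_{n-1} is meant.

Upper bound: the algebra is built up from words in which the highest generator occurs at most once,
so by cyclicity a trace is determined by its values on increasing products of distinct generators
(`trace_eq_zero_of_word`). Cyclicity and e_a e_{a±1} e_a = e_a then slide letters to the left and
fill gaps at the cost of δ, until an initial block of even length remains (`trace_word_eq_zero`).
This leaves ⌊n/2⌋ + 1 values.

Lower bound: TL_n acts on a chain of n two-state spins and preserves the number of spins of each
kind, so the trace weighted by z and z' per spin is again a trace. For zz' = 1 it behaves like
closing a diagram in an annulus: contractible loops count δ, essential loops z + z'. It is (z +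
z')^{n-2j} on the test elements with 2j < n, and δ on the full product when n = 2j
(`spinTrace_testWord`). Since z + z' is arbitrary, distinct powers separate the coordinates, so the
spin traces realise all value vectors if δ ≠ 0 or n is odd. They vanish on the Jacobson radical, and
by Wedderburn the matrix traces are a basis of the traces that do so
(`isBasisOf_semisimpleMatrixTraces`).

For δ = 0 and n = 2m the last coordinate is lost: the odd-even word has the same value as the full
product under every trace, but squares to zero, so a trace that vanishes on the radical kills it.
This leaves m matrix traces. The missing trace is a derivative: over the dual numbers q is deformed
so that δ = ε, with z + z' = 0. The twisted trace then vanishes at ε = 0, hence its ε-coefficient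
respects e_i² = 0, and it equals 1 on the full product (`exists_extra_trace`). -/

/-- `e 0, …, e (N - 1)` satisfy the Temperley-Lieb relations with loop parameter `δ`. -/
structure IsTLFamily {A : Type*} [Ring A] [Algebra ℂ A] (δ : ℂ) (N : ℕ) (e : ℕ → A) : Prop where
  sq : ∀ i < N, e i * e i = δ • e i
  up : ∀ i, i + 1 < N → e i * e (i + 1) * e i = e i
  down : ∀ i, i + 1 < N → e (i + 1) * e i * e (i + 1) = e (i + 1)
  comm : ∀ i j, i + 1 < j → j < N → Commute (e i) (e j)

/-- The product of the letters `e i`, `i ∈ S`, `a ≤ i < a + k`, in increasing order. -/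
def word {A : Type*} [Ring A] (e : ℕ → A) (S : Finset ℕ) (a k : ℕ) : A :=
  ((List.range' a k).map fun i => if i ∈ S then e i else 1).prod

/-! ### Increasing products of generators -/

section Word

variable {A : Type*} [Ring A] {e : ℕ → A} {S T : Finset ℕ} {a k m : ℕ}

@[simp] lemma word_zero : word e S a 0 = 1 := by simp [word]

lemma word_add : word e S a (k + m) = word e S a k * word e S (a + k) m := by
  simp [word, ← List.prod_append, ← List.map_append]

lemma word_one : word e S a 1 = if a ∈ S then e a else 1 := by
  simp [word]

lemma word_succ : word e S a (k + 1) = word e S a k * if a + k ∈ S then e (a + k) else 1 := by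
  rw [word_add, word_one]

lemma word_succ' : word e S a (k + 1) = (if a ∈ S then e a else 1) * word e S (a + 1) k := by
  rw [add_comm, word_add, word_one]

lemma word_congr (h : ∀ i, a ≤ i → i < a + k → (i ∈ S ↔ i ∈ T)) :
    word e S a k = word e T a k := by
  unfold word
  congr 1
  refine List.map_congr_left fun i hi => ?_
  rw [List.mem_range'_1] at hi
  simp [h i hi.1 hi.2]

lemma commute_word {x : A} (h : ∀ i, a ≤ i → i < a + k → i ∈ S → Commute x (e i)) :
    Commute x (word e S a k) := by
  induction k with
  | zero => simp
  | succ k ih =>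
    rw [word_succ]
    refine (ih fun i h1 h2 => h i h1 (by omega)).mul_right ?_
    split_ifs with h'
    · exact h _ (by omega) (by omega) h'
    · exact Commute.one_right x

end Word

/-! ### Moving letters inside a trace -/

section Rules

variable {A : Type*} [Ring A] [Algebra ℂ A] {δ : ℂ} {N : ℕ} {e : ℕ → A} {S : Finset ℕ} {a : ℕ}
  {t : A →ₗ[ℂ] ℂ}

lemma IsTLFamily.commute_word_low (he : IsTLFamily δ N e) {i k : ℕ} (hi : i < N)
    (h : a + k < i) : Commute (e i) (word e S a k) :=
  commute_word fun j h1 h2 _ => (he.comm j i (by omega) hi).symm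

lemma IsTLFamily.commute_word_high (he : IsTLFamily δ N e) {i k : ℕ}
    (hk : a + k ≤ N) (h : i + 1 < a) : Commute (e i) (word e S a k) :=
  commute_word fun j h1 h2 _ => he.comm i j (by omega) (by omega)

/-- A letter without neighbours may be joined by the letter to its left, at the cost of `δ`. -/
lemma IsTLFamily.trace_insert_left (he : IsTLFamily δ N e) (ht : t ∈ traceSpace A)
    (ha : a ∉ S) (ha1 : a + 1 ∈ S) (haN : a + 1 < N) (ha2 : a + 2 < N → a + 2 ∉ S) :
    t (word e S 0 N) = δ * t (word e (insert a S) 0 N) := by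
  obtain ⟨M, rfl⟩ : ∃ M, N = a + (1 + (1 + M)) := ⟨N - a - 2, by omega⟩
  have ht : ∀ x y, t (x * y) = t (y * x) := ht
  simp only [word_add, word_one, zero_add, ha, ha1, if_false, if_true, one_mul,
    Finset.mem_insert_self, Finset.mem_insert_of_mem ha1]
  rw [word_congr (S := insert a S) (T := S) (a := 0),
    word_congr (S := insert a S) (T := S) (a := a + 1 + 1)]
  rotate_left
  · intro i h1 h2; rw [Finset.mem_insert]; exact or_iff_right (by omega)
  · intro i h1 h2; rw [Finset.mem_insert]; exact or_iff_right (by omega)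
  set P := word e S 0 a
  set Q := word e S (a + 1 + 1) M with hQ
  have hP : Commute (e (a + 1)) P := he.commute_word_low haN (by omega)
  have hQ : Commute (e (a + 1)) Q := by
    refine commute_word fun j h1 h2 h3 => he.comm _ _ ?_ (by omega)
    rcases Nat.eq_or_lt_of_le h1 with h | h
    · subst h; exact absurd h3 (ha2 (by omega))
    · exact h
  -- Expand e_{a+1} as e_{a+1} e_a e_{a+1}. The left outer factor passes P, goes round by cyclicity,
  -- passes Q and meets its twin, which gives δ.
  calc t (P * (e (a + 1) * Q)) = t (e (a + 1) * (P * e a * e (a + 1) * Q)) := by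
        conv_lhs => rw [← he.down a haN]
        simp only [mul_assoc, hP.left_comm]
    _ = t (P * (e a * ((e (a + 1) * e (a + 1)) * Q))) := by
        rw [ht]; simp only [mul_assoc, ← hQ.eq]
    _ = δ * t (P * (e a * (e (a + 1) * Q))) := by
        rw [he.sq _ haN]; simp

/-- In a pair of adjacent letters the second one may jump to the left of the first one. -/
lemma IsTLFamily.trace_jump_left (he : IsTLFamily δ N e) (ht : t ∈ traceSpace A)
    (ha : a ∉ S) (ha1 : a + 1 ∈ S) (haN : a + 2 < N) (ha2 : a + 2 ∈ S) :
    t (word e S 0 N) = t (word e (insert a (S.erase (a + 2))) 0 N) := by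
  obtain ⟨M, rfl⟩ : ∃ M, N = a + (1 + (1 + (1 + M))) := ⟨N - a - 3, by omega⟩
  have ht : ∀ x y, t (x * y) = t (y * x) := ht
  simp only [word_add, word_one, zero_add, add_assoc, ha, ha1, ha2, if_false, if_true, one_mul,
    Finset.mem_insert, Finset.mem_erase, Nat.reduceAdd, true_or]
  rw [if_pos (by simp), if_neg (by simp), one_mul,
    word_congr (S := insert a (S.erase (a + 2))) (T := S) (a := 0),
    word_congr (S := insert a (S.erase (a + 2))) (T := S) (a := a + 3)]
  rotate_left
  · intro i h1 h2; rw [Finset.mem_insert, Finset.mem_erase]; constructor <;> grind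
  · intro i h1 h2; rw [Finset.mem_insert, Finset.mem_erase]; constructor <;> grind
  set P := word e S 0 a
  set Q := word e S (a + 3) M
  have hP : Commute (e (a + 1)) P := he.commute_word_low (by omega) (by omega)
  have hQ : Commute (e (a + 1)) Q := he.commute_word_high (by omega) (by omega)
  -- The same circular move, but the returning e_{a+1} now meets e_{a+1} e_{a+2} and absorbs
  -- e_{a+2}.
  calc t (P * (e (a + 1) * (e (a + 2) * Q)))
      = t (e (a + 1) * (P * e a * e (a + 1) * e (a + 2) * Q)) := by
        conv_lhs => rw [← he.down a (by omega)]
        simp only [mul_assoc, hP.left_comm]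
    _ = t (P * (e a * ((e (a + 1) * e (a + 1 + 1) * e (a + 1)) * Q))) := by
        rw [ht]; simp only [mul_assoc, hQ.eq]
    _ = _ := by rw [he.up _ (by omega)]

/-- If `e 0` occurs and `e 1` does not, `e 1` may be inserted at the cost of `δ`. -/
lemma IsTLFamily.trace_insert_one (he : IsTLFamily δ N e) (ht : t ∈ traceSpace A)
    (h0 : 0 ∈ S) (h1 : 1 ∉ S) (hN : 1 < N) :
    t (word e S 0 N) = δ * t (word e (insert 1 S) 0 N) := by
  obtain ⟨M, rfl⟩ : ∃ M, N = 1 + (1 + M) := ⟨N - 2, by omega⟩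
  have ht : ∀ x y, t (x * y) = t (y * x) := ht
  simp only [word_add, word_one, zero_add, h0, h1, if_false, if_true, one_mul,
    Finset.mem_insert_self, Finset.mem_insert_of_mem h0]
  rw [word_congr (S := insert 1 S) (T := S) (a := 1 + 1)]
  rotate_left
  · intro i h1 h2; rw [Finset.mem_insert]; exact or_iff_right (by omega)
  set Q := word e S (1 + 1) M
  have hQ : Commute (e 0) Q := he.commute_word_high (by omega) (by omega)
  calc t (e 0 * Q) = t (e 0 * e 1 * Q * e 0) := by
        rw [mul_assoc _ Q, ← hQ.eq, ← mul_assoc, he.up 0 hN]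
    _ = t ((e 0 * e 0) * (e 1 * Q)) := by rw [ht]; simp only [mul_assoc]
    _ = _ := by rw [he.sq _ (by omega)]; simp

/-- In a pair of adjacent letters the first one may jump to the right of the second one. -/
lemma IsTLFamily.trace_jump_right (he : IsTLFamily δ N e) (ht : t ∈ traceSpace A)
    (ha : a ∈ S) (ha1 : a + 1 ∈ S) (haN : a + 2 < N) (ha2 : a + 2 ∉ S) :
    t (word e S 0 N) = t (word e (insert (a + 2) (S.erase a)) 0 N) := by
  have h := he.trace_jump_left (S := insert (a + 2) (S.erase a)) (a := a) ht (by simp) (by simp [ha1])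
    haN (by simp)
  rw [h]
  congr 2
  ext i
  simp only [Finset.mem_insert, Finset.mem_erase]
  grind

/-- An odd initial block may be extended by one letter at the cost of `δ`. -/
lemma IsTLFamily.trace_insert_odd (he : IsTLFamily δ N e) (ht : t ∈ traceSpace A) (k : ℕ)
    (S : Finset ℕ) (hS : ∀ i < 2 * k + 1, i ∈ S) (hk : 2 * k + 1 ∉ S) (hN : 2 * k + 1 < N) :
    t (word e S 0 N) = δ * t (word e (insert (2 * k + 1) S) 0 N) := by
  induction k generalizing S with
  | zero => exact he.trace_insert_one ht (hS 0 (by omega)) hk hN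
  | succ k ih =>
    -- Moving letter 2k+1 to 2k+3 leaves an initial block that is shorter by two letters with a gap
    -- at 2k+1; induction fills the gap and produces the δ.
    rw [he.trace_jump_right (a := 2 * k + 1) ht (hS _ (by omega)) (hS _ (by omega)) (by omega) hk,
      ih _ _ (by simp) (by omega)]
    · congr 3
      ext i
      have := hS (2 * k + 1) (by omega)
      simp only [Finset.mem_insert, Finset.mem_erase]
      grind
    · intro i hi
      have := hS i (by omega)
      simp only [Finset.mem_insert, Finset.mem_erase]
      grind

/-- A trace is determined on ordered words by its values on the even initial blocks. -/
lemma IsTLFamily.trace_word_eq_zero (he : IsTLFamily δ N e) (ht : t ∈ traceSpace A)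
    (h : ∀ j ≤ (N + 1) / 2, t (word e (Finset.range (2 * j)) 0 N) = 0) (S : Finset ℕ) :
    t (word e S 0 N) = 0 := by
  -- Each missing position i weighs N - i: filling a gap removes its weight, and a jump to the left
  -- replaces a gap at a by a lighter one at a + 2.
  induction hμ : ∑ i ∈ Finset.range N \ S, (N - i) using Nat.strong_induction_on
    generalizing S with
  | _ μ ih =>
  subst hμ
  by_cases hex : ∃ a, a ∉ S ∧ a + 1 ∈ S ∧ a + 1 < N
  · obtain ⟨a, ha, ha1, haN⟩ := hex
    by_cases ha2 : a + 2 < N ∧ a + 2 ∈ S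
    · rw [he.trace_jump_left ht ha ha1 ha2.1 ha2.2]
      refine ih _ ?_ _ rfl
      have e1 : Finset.range N \ insert a (S.erase (a + 2)) =
          insert (a + 2) ((Finset.range N \ S).erase a) := by
        ext i
        simp only [Finset.mem_insert, Finset.mem_erase, Finset.mem_sdiff, Finset.mem_range]
        grind
      have e2 : a ∈ Finset.range N \ S := by simp [ha]; omega
      rw [e1, Finset.sum_insert (by simp [ha2.2]), ← Finset.add_sum_erase _ _ e2]
      omega
    · rw [he.trace_insert_left ht ha ha1 haN (fun h1 h2 => ha2 ⟨h1, h2⟩)]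
      rw [ih _ ?_ _ rfl, mul_zero]
      have e1 : Finset.range N \ insert a S = (Finset.range N \ S).erase a := by
        ext i
        simp only [Finset.mem_insert, Finset.mem_erase, Finset.mem_sdiff, Finset.mem_range]
        grind
      have e2 : a ∈ Finset.range N \ S := by simp [ha]; omega
      rw [e1, ← Finset.add_sum_erase _ _ e2]
      omega
  · push Not at hex
    have hdown : ∀ l, (∀ i, i < N → (i ∈ S ↔ i < l)) →
        word e S 0 N = word e (Finset.range l) 0 N :=
      fun l hl => word_congr fun i _ hi => by rw [hl i (by omega), Finset.mem_range]
    obtain ⟨l, hlN, hl⟩ : ∃ l ≤ N, ∀ i, i < N → (i ∈ S ↔ i < l) := by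
      by_cases hall : ∀ i < N, i ∈ S
      · exact ⟨N, le_rfl, fun i hi => by simp [hi, hall i hi]⟩
      · push Not at hall
        refine ⟨Nat.find hall, (Nat.find_spec hall).1.le, fun i hi => ⟨fun hiS => ?_, fun hil => ?_⟩⟩
        · by_contra hlt
          push Not at hlt
          have : ∀ j, Nat.find hall ≤ j → j < N → j ∉ S := by
            intro j hj
            induction j, hj using Nat.le_induction with
            | base => exact fun _ => (Nat.find_spec hall).2
            | succ j hj ihj =>
              intro hjN hjS
              have := hex j (ihj (by omega)) hjS
              omega
          exact this i hlt hi hiS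
        · by_contra hiS
          exact Nat.find_min hall hil ⟨hi, hiS⟩
    rw [hdown l hl]
    rcases Nat.even_or_odd' l with ⟨j, rfl | rfl⟩
    · exact h j (by omega)
    · rcases Nat.lt_or_ge (2 * j + 1) N with hlt | hge
      · rw [he.trace_insert_odd ht j _ (by simp) (by simp) hlt, ← Finset.range_add_one]
        rw [show 2 * j + 1 + 1 = 2 * (j + 1) by ring, h (j + 1) (by omega), mul_zero]
      -- An odd block can no longer be extended only when it contains all N letters; it is then the
      -- test word of index j + 1, whose last position lies outside the word.
      · rw [word_congr (T := Finset.range (2 * (j + 1)))]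
        · exact h _ (by omega)
        · intro i _ hi
          simp only [Finset.mem_range]
          omega

end Rules

/-! ### Normal form, finite dimension, and determination of traces by words -/

section Spanning

variable {A : Type*} [Ring A] [Algebra ℂ A] {δ : ℂ} {N : ℕ} {e : ℕ → A}

/-- The subspace of `A` underlying the subalgebra generated by `e 0, …, e (k - 1)`. -/
def initialSpace (e : ℕ → A) (k : ℕ) : Submodule ℂ A :=
  Subalgebra.toSubmodule (Algebra.adjoin ℂ (e '' Set.Iio k))

lemma mem_initialSpace {k i : ℕ} (h : i < k) : e i ∈ initialSpace e k :=
  Algebra.subset_adjoin ⟨i, h, rfl⟩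

lemma initialSpace_mul_self (k : ℕ) : initialSpace e k * initialSpace e k = initialSpace e k :=
  (Algebra.adjoin ℂ (e '' Set.Iio k)).isIdempotentElem_toSubmodule

lemma one_mem_initialSpace (k : ℕ) : (1 : A) ∈ initialSpace e k :=
  one_mem (Algebra.adjoin ℂ (e '' Set.Iio k))

lemma mul_mem_initialSpace {k : ℕ} {x y : A} (hx : x ∈ initialSpace e k)
    (hy : y ∈ initialSpace e k) : x * y ∈ initialSpace e k :=
  (Algebra.adjoin ℂ (e '' Set.Iio k)).mul_mem hx hy

lemma initialSpace_zero : initialSpace e 0 = 1 := by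
  simp [initialSpace, Algebra.toSubmodule_bot]

lemma IsTLFamily.commute_initialSpace (he : IsTLFamily δ N e) {k j : ℕ} (hj : j < N) (hk : k < j)
    {x : A} (hx : x ∈ initialSpace e k) : Commute x (e j) := by
  have : Algebra.adjoin ℂ (e '' Set.Iio k) ≤ Subalgebra.centralizer ℂ {e j} := by
    rw [Algebra.adjoin_le_iff]
    rintro _ ⟨i, hi, rfl⟩
    rw [SetLike.mem_coe, Subalgebra.mem_centralizer_iff]
    rintro _ rfl
    exact (he.comm i j (by simp at hi; omega) hj).symm
  exact ((Subalgebra.mem_centralizer_iff ℂ).1 (this hx) _ rfl).symm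

/-- With M the algebra of the first k letters, the hypothesis is exactly what makes M + M e_k M
closed under multiplication. -/
lemma initialSpace_succ_le_of (k : ℕ)
    (h : ∀ y ∈ initialSpace e k, e k * y * e k ∈
      initialSpace e k * Submodule.span ℂ {e k} * initialSpace e k) :
    initialSpace e (k + 1) ≤
      initialSpace e k ⊔ initialSpace e k * Submodule.span ℂ {e k} * initialSpace e k := by
  set M := initialSpace e k with hM
  set E := Submodule.span ℂ {e k} with hE
  have hMM : M * M = M := initialSpace_mul_self k
  have h1 : (1 : A) ∈ M := one_mem_initialSpace k
  have hEME : E * M * E ≤ M * E * M := by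
    rw [Submodule.mul_le]
    intro x hx z hz
    obtain ⟨c, rfl⟩ := Submodule.mem_span_singleton.1 hz
    refine Submodule.mul_induction_on hx ?_ ?_
    · intro w hw y hy
      obtain ⟨d, rfl⟩ := Submodule.mem_span_singleton.1 hw
      simpa using Submodule.smul_mem _ c (Submodule.smul_mem _ d (h y hy))
    · intro x y hx hy
      rw [add_mul]
      exact add_mem hx hy
  have hB : (M ⊔ M * E * M) * (M ⊔ M * E * M) ≤ M ⊔ M * E * M := by
    rw [Submodule.sup_mul, Submodule.mul_sup, Submodule.mul_sup]
    have h2 : M * (M * E * M) = M * E * M := by rw [← mul_assoc, ← mul_assoc, hMM]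
    have h3 : M * E * M * M = M * E * M := by rw [mul_assoc _ M M, hMM]
    have h4 : M * E * M * (M * E * M) ≤ M * E * M := by
      calc M * E * M * (M * E * M) = M * (E * (M * M) * E) * M := by simp only [mul_assoc]
        _ ≤ M * (M * E * M) * M := by
            rw [hMM]
            gcongr
        _ = M * E * M := by rw [h2, h3]
    rw [hMM, h2, h3]
    exact sup_le (sup_le le_sup_left le_sup_right) (sup_le le_sup_right (h4.trans le_sup_right))
  let B : Subalgebra ℂ A := Submodule.toSubalgebra (M ⊔ M * E * M)
    (Submodule.mem_sup_left h1) fun x y hx hy => hB (Submodule.mul_mem_mul hx hy)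
  have : Algebra.adjoin ℂ (e '' Set.Iio (k + 1)) ≤ B := by
    rw [Algebra.adjoin_le_iff]
    rintro _ ⟨i, hi, rfl⟩
    change e i ∈ M ⊔ M * E * M
    rcases Nat.lt_succ_iff_lt_or_eq.1 hi with hi | rfl
    · exact Submodule.mem_sup_left (mem_initialSpace hi)
    · refine Submodule.mem_sup_right ?_
      simpa using Submodule.mul_mem_mul
        (Submodule.mul_mem_mul h1 (Submodule.mem_span_singleton_self (e i))) h1
  exact this

/-- Every element of the algebra generated by `e 0, …, e k` is a combination of words that
contain `e k` at most once. -/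
lemma IsTLFamily.initialSpace_succ_le (he : IsTLFamily δ N e) (k : ℕ) (hk : k < N) :
    initialSpace e (k + 1) ≤
      initialSpace e k ⊔ initialSpace e k * Submodule.span ℂ {e k} * initialSpace e k := by
  have hmem : ∀ k, ∀ x ∈ initialSpace e k, ∀ y ∈ initialSpace e k,
      x * e k * y ∈ initialSpace e k * Submodule.span ℂ {e k} * initialSpace e k :=
    fun k x hx y hy => Submodule.mul_mem_mul
      (Submodule.mul_mem_mul hx (Submodule.mem_span_singleton_self _)) hy
  have hmem' : ∀ k, k < N → ∀ x ∈ initialSpace e k, Commute x (e k) → e k * x * e k ∈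
      initialSpace e k * Submodule.span ℂ {e k} * initialSpace e k := by
    intro k hk x hx hc
    have h : e k * x * e k = δ • (x * e k) := by
      rw [← hc.eq, mul_assoc, he.sq k hk, mul_smul_comm]
    rw [h]
    simpa using Submodule.smul_mem _ δ (hmem k x hx 1 (one_mem_initialSpace k))
  induction k with
  | zero =>
    refine initialSpace_succ_le_of 0 fun y hy => hmem' 0 hk y hy ?_
    rw [initialSpace_zero] at hy
    obtain ⟨c, rfl⟩ := Submodule.mem_one.1 hy
    exact Algebra.commutes c _
  | succ k ih =>
    refine initialSpace_succ_le_of _ fun x hx => ?_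
    have hmono : initialSpace e k ≤ initialSpace e (k + 1) :=
      Algebra.adjoin_mono (Set.image_mono fun i (hi : i < k) => Nat.lt_succ_of_lt hi)
    -- By induction x contains e_k at most once. Between two copies of e_{k+1} there is thus either
    -- nothing that obstructs squaring, or a single e_k, and e_{k+1} e_k e_{k+1} collapses.
    obtain ⟨y, hy, z, hz, rfl⟩ := Submodule.mem_sup.1 (ih (by omega) hx)
    rw [mul_add, add_mul]
    refine add_mem (hmem' _ hk _ (hmono hy)
      (he.commute_initialSpace hk (Nat.lt_succ_self k) hy)) ?_
    refine Submodule.mul_induction_on hz ?_ ?_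
    · intro w hw v hv
      refine Submodule.mul_induction_on hw ?_ ?_
      · intro u hu f hf
        obtain ⟨c, rfl⟩ := Submodule.mem_span_singleton.1 hf
        have h1 := (he.commute_initialSpace hk (Nat.lt_succ_self k) hu).eq
        have h2 := (he.commute_initialSpace hk (Nat.lt_succ_self k) hv).eq
        have : e (k + 1) * (u * (c • e k) * v) * e (k + 1) = c • (u * e (k + 1) * v) := by
          calc _ = c • ((e (k + 1) * u) * e k * (v * e (k + 1))) := by
                simp only [mul_assoc, smul_mul_assoc, mul_smul_comm]
            _ = c • (u * (e (k + 1) * e k * e (k + 1)) * v) := by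
                rw [← h1, h2]; simp only [mul_assoc]
            _ = _ := by rw [he.down k hk]
        rw [this]
        exact Submodule.smul_mem _ _ (hmem _ _ (hmono hu) _ (hmono hv))
      · intro x y hx hy
        rw [add_mul, mul_add, add_mul]
        exact add_mem hx hy
    · intro x y hx hy
      rw [mul_add, add_mul]
      exact add_mem hx hy

lemma IsTLFamily.fg_initialSpace (he : IsTLFamily δ N e) (k : ℕ) (hk : k ≤ N) :
    (initialSpace e k).FG := by
  induction k with
  | zero => rw [initialSpace_zero, Submodule.one_eq_span]; exact Submodule.fg_span_singleton 1
  | succ k ih =>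
    have ih := ih (by omega)
    exact Submodule.FG.of_le
      (ih.sup ((ih.mul (Submodule.fg_span_singleton _)).mul ih)) (he.initialSpace_succ_le k hk)

lemma IsTLFamily.finite (he : IsTLFamily δ N e) (hgen : Algebra.adjoin ℂ (e '' Set.Iio N) = ⊤) :
    Module.Finite ℂ A := by
  refine ⟨?_⟩
  have := he.fg_initialSpace N le_rfl
  rwa [initialSpace, hgen, Algebra.top_toSubmodule] at this

/-- A trace that vanishes on the ordered words vanishes. -/
lemma IsTLFamily.trace_eq_zero_of_word (he : IsTLFamily δ N e)
    (hgen : Algebra.adjoin ℂ (e '' Set.Iio N) = ⊤) {t : A →ₗ[ℂ] ℂ} (ht : t ∈ traceSpace A)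
    (h : ∀ S, t (word e S 0 N) = 0) : t = 0 := by
  -- An arbitrary element in the first k letters is followed by an increasing word in the others; k
  -- = 0 is the hypothesis and k = N is the claim.
  have key : ∀ k ≤ N, ∀ x ∈ initialSpace e k, ∀ S, t (x * word e S k (N - k)) = 0 := by
    intro k
    induction k with
    | zero =>
      intro _ x hx S
      rw [initialSpace_zero] at hx
      obtain ⟨c, rfl⟩ := Submodule.mem_one.1 hx
      rw [← Algebra.smul_def, map_smul, Nat.sub_zero, h, smul_zero]
    | succ k ih =>
      intro hk x hx S
      have ih := ih (by omega)
      have hlen : N - k = N - (k + 1) + 1 := by omega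
      have hS : ∀ T : Finset ℕ, (∀ i, k < i → (i ∈ T ↔ i ∈ S)) → word e T k (N - k) =
          (if k ∈ T then e k else 1) * word e S (k + 1) (N - (k + 1)) := by
        intro T hT
        rw [hlen, word_succ', word_congr (S := T) (T := S)]
        exact fun i hi _ => hT i hi
      obtain ⟨y, hy, z, hz, rfl⟩ := Submodule.mem_sup.1 (he.initialSpace_succ_le k hk hx)
      rw [add_mul, map_add]
      have h1 : t (y * word e S (k + 1) (N - (k + 1))) = 0 := by
        have := ih y hy (S.erase k)
        rwa [hS (S.erase k) (fun i hi => by simp [hi.ne']), if_neg (by simp), one_mul] at this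
      rw [h1, zero_add]
      refine Submodule.mul_induction_on hz ?_ ?_
      · intro w hw v hv
        refine Submodule.mul_induction_on hw ?_ ?_
        · intro u hu f hf
          obtain ⟨c, rfl⟩ := Submodule.mem_span_singleton.1 hf
          -- In u e_k v R the factor v passes the tail R and goes round by cyclicity, so that e_k
          -- joins the tail.
          have hc : Commute v (word e S (k + 1) (N - (k + 1))) :=
            commute_word fun i hi1 hi2 _ => he.commute_initialSpace (by omega) (by omega) hv
          have h2 := ih (v * u) (mul_mem_initialSpace hv hu) (insert k S)
          rw [hS (insert k S) (fun i hi => by simp [hi.ne']), if_pos (by simp)] at h2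
          have ht : ∀ x y, t (x * y) = t (y * x) := ht
          rw [mul_assoc _ v, hc.eq, ← mul_assoc, ht, mul_smul_comm, smul_mul_assoc,
            mul_smul_comm, map_smul, mul_assoc u, ← mul_assoc v u, h2, smul_zero]
        · intro x y hx hy
          rw [add_mul, add_mul, map_add, hx, hy, add_zero]
      · intro x y hx hy
        rw [add_mul, map_add, hx, hy, add_zero]
  ext x
  have := key N le_rfl x (by rw [initialSpace, hgen]; trivial) ∅
  simpa using this

end Spanning

/-! ### The odd-even word -/

section OddEven

variable {A : Type*} [Ring A] {δ : ℂ} {N : ℕ} {e : ℕ → A}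

/-- The product `e 0 * e 2 * ⋯` of `k` factors with even indices. -/
def evenProd (e : ℕ → A) (k : ℕ) : A := (List.ofFn fun i : Fin k => e (2 * i.val)).prod

/-- The product `e 1 * e 3 * ⋯` of `k` factors with odd indices. -/
def oddProd (e : ℕ → A) (k : ℕ) : A := (List.ofFn fun i : Fin k => e (2 * i.val + 1)).prod

@[simp] lemma evenProd_zero : evenProd e 0 = 1 := by simp [evenProd]

@[simp] lemma oddProd_zero : oddProd e 0 = 1 := by simp [oddProd]

lemma evenProd_succ (k : ℕ) : evenProd e (k + 1) = evenProd e k * e (2 * k) := by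
  rw [evenProd, List.ofFn_succ', List.concat_eq_append, List.prod_append, List.prod_singleton]
  rfl

lemma oddProd_succ (k : ℕ) : oddProd e (k + 1) = oddProd e k * e (2 * k + 1) := by
  rw [oddProd, List.ofFn_succ', List.concat_eq_append, List.prod_append, List.prod_singleton]
  rfl


lemma commute_evenProd {x : A} {k : ℕ} (h : ∀ i < k, Commute x (e (2 * i))) :
    Commute x (evenProd e k) := by
  induction k with
  | zero => simp
  | succ k ih =>
    rw [evenProd_succ]
    exact (ih fun i hi => h i (by omega)).mul_right (h k (by omega))

lemma commute_oddProd {x : A} {k : ℕ} (h : ∀ i < k, Commute x (e (2 * i + 1))) :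
    Commute x (oddProd e k) := by
  induction k with
  | zero => simp
  | succ k ih =>
    rw [oddProd_succ]
    exact (ih fun i hi => h i (by omega)).mul_right (h k (by omega))

variable [Algebra ℂ A]

lemma IsTLFamily.evenProd_mul_oddProd_mul_evenProd (he : IsTLFamily δ N e) (k : ℕ)
    (hk : 2 * k < N) :
    evenProd e (k + 1) * oddProd e k * evenProd e (k + 1) = δ • evenProd e (k + 1) := by
  induction k with
  | zero => simp [evenProd_succ, he.sq 0 hk]
  | succ k ih =>
    have ih := ih (by omega)
    have h1 : Commute (e (2 * (k + 1))) (oddProd e k) :=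
      commute_oddProd fun i hi => (he.comm _ _ (by omega) (by omega)).symm
    have h2 : Commute (e (2 * (k + 1))) (evenProd e (k + 1)) := by
      refine commute_evenProd fun i hi => (he.comm _ _ (by omega) (by omega)).symm
    rw [evenProd_succ (k + 1), oddProd_succ k]
    calc _ = evenProd e (k + 1) * (e (2 * (k + 1)) * oddProd e k) * e (2 * k + 1) *
          (evenProd e (k + 1) * e (2 * (k + 1))) := by simp only [mul_assoc]
      _ = evenProd e (k + 1) * oddProd e k *
          (e (2 * k + 1 + 1) * e (2 * k + 1) * e (2 * k + 1 + 1)) * evenProd e (k + 1) := by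
          rw [h1.eq, ← h2.eq]; simp only [mul_assoc]; rfl
      _ = evenProd e (k + 1) * oddProd e k * (e (2 * (k + 1)) * evenProd e (k + 1)) := by
          rw [he.down _ (by omega), mul_assoc _ (e _)]; rfl
      _ = _ := by
          rw [h2.eq, ← mul_assoc, ih, smul_mul_assoc]

/-- The full increasing word is rearranged two letters at a time: with E, F the even and odd parts
already collected, t(E F e R) = t(e R E F) = t(E e R F) = t(E e F R), because the next even letter e
commutes with E and the tail R with both parts. -/
lemma IsTLFamily.trace_evenProd_mul_oddProd (he : IsTLFamily δ N e) {t : A →ₗ[ℂ] ℂ}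
    (ht : t ∈ traceSpace A) {S : Finset ℕ} (hS : ∀ i < N, i ∈ S) (k : ℕ) (hk : N = 2 * k + 1) :
    t (evenProd e (k + 1) * oddProd e k) = t (word e S 0 N) := by
  have ht : ∀ x y, t (x * y) = t (y * x) := ht
  have key : ∀ j ≤ k, t (evenProd e (j + 1) * oddProd e j * word e S (2 * j + 1) (N - (2 * j + 1)))
      = t (word e S 0 N) := by
    intro j
    induction j with
    | zero =>
      intro _
      rw [show N = N - 1 + 1 by omega, word_succ', if_pos (hS 0 (by omega))]
      simp [evenProd_succ]
    | succ j ih =>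
      intro hj
      rw [← ih (by omega)]
      have hlen : N - (2 * j + 1) = N - (2 * (j + 1) + 1) + 1 + 1 := by omega
      rw [hlen, word_succ', word_succ', if_pos (hS _ (by omega)), if_pos (hS _ (by omega))]
      rw [evenProd_succ (j + 1), oddProd_succ j]
      change t (_ * e (2 * (j + 1)) * _ * word e S (2 * (j + 1) + 1) _) =
        t (_ * (_ * (e (2 * (j + 1)) * word e S (2 * (j + 1) + 1) _)))
      set R := word e S (2 * (j + 1) + 1) (N - (2 * (j + 1) + 1))
      have hE : Commute (e (2 * (j + 1))) (evenProd e (j + 1)) :=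
        commute_evenProd fun i hi => (he.comm _ _ (by omega) (by omega)).symm
      have hRE : Commute R (evenProd e (j + 1)) := commute_evenProd fun i hi =>
        (he.commute_word_high (by omega) (by omega)).symm
      have hRF : Commute R (oddProd e (j + 1)) := commute_oddProd fun i hi =>
        (he.commute_word_high (by omega) (by omega)).symm
      have hF := oddProd_succ (e := e) j
      rw [← hF]
      calc _ = t (evenProd e (j + 1) * e (2 * (j + 1)) * (R * oddProd e (j + 1))) := by
            rw [hRF.eq, mul_assoc (_ * e _)]
        _ = t (e (2 * (j + 1)) * R * (evenProd e (j + 1) * oddProd e (j + 1))) := by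
            rw [← hE.eq, mul_assoc, ← mul_assoc _ R, ← hRE.eq]; simp only [mul_assoc]
        _ = _ := by rw [ht, hF]; simp only [mul_assoc]
  have := key k le_rfl
  rwa [show N - (2 * k + 1) = 0 by omega, word_zero, mul_one] at this

end OddEven

/-! ### Cup-cap operators on a spin chain -/

section Spin

/-- Normal form of the configurations met in a triple product of neighbouring contractions: only the
last value written at each site survives. -/
lemma update_three {X Y : Type*} [DecidableEq X] {a b c : X} (hac : a ≠ c) (hbc : b ≠ c)
    (σ : X → Y) (s s' u u' v v' : Y) :
    Function.update (Function.update (Function.update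
      (Function.update (Function.update (Function.update σ a s) b s') b u) c u') a v) b v' =
    Function.update (Function.update (Function.update σ a v) b v') c u' := by
  funext x
  simp only [Function.update_apply]
  split_ifs <;> simp_all

lemma update_three' {X Y : Type*} [DecidableEq X] {a b c : X} (hab : a ≠ b) (hac : a ≠ c)
    (σ : X → Y) (s s' u u' v v' : Y) :
    Function.update (Function.update (Function.update
      (Function.update (Function.update (Function.update σ b s) c s') a u) b u') b v) c v' =
    Function.update (Function.update (Function.update σ b v) c v') a u := by
  funext x
  simp only [Function.update_apply]
  split_ifs <;> simp_all

variable {X : Type*} [DecidableEq X] {R : Type*} [CommRing R] (q q' : R)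

/-- Coefficient of the cup vector `|01⟩ + q' |10⟩`. -/
def cupCoeff (s s' : Bool) : R := if s = s' then 0 else if s then q' else 1

/-- Coefficient of the cap covector `q ⟨01| + ⟨10|`. -/
def capCoeff (s : Bool) : R := if s then 1 else q

/-- The operator of the spin chain with sites `X` that contracts the sites `a` and `b`. -/
def spinOp (a b : X) : ((X → Bool) → R) →ₗ[R] ((X → Bool) → R) where
  toFun f σ := cupCoeff q' (σ a) (σ b) *
    ∑ s : Bool, capCoeff q s * f (Function.update (Function.update σ a s) b !s)
  map_add' f g := by
    funext σ
    simp only [Pi.add_apply, mul_add, Finset.sum_add_distrib]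
  map_smul' c f := by
    funext σ
    simp only [Pi.smul_apply, smul_eq_mul, RingHom.id_apply, Finset.mul_sum]
    exact Finset.sum_congr rfl fun s _ => by ring

lemma spinOp_apply (a b : X) (f : (X → Bool) → R) (σ : X → Bool) :
    spinOp q q' a b f σ = cupCoeff q' (σ a) (σ b) *
      (q * f (Function.update (Function.update σ a false) b true) +
        f (Function.update (Function.update σ a true) b false)) := by
  simp [spinOp, capCoeff, add_comm]

variable {q q'}

lemma spinOp_sq {a b : X} (hab : a ≠ b) :
    spinOp q q' a b * spinOp q q' a b = (q + q') • spinOp q q' a b := by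
  refine LinearMap.ext fun f => funext fun σ => ?_
  simp only [Module.End.mul_apply, LinearMap.smul_apply, Pi.smul_apply, smul_eq_mul, spinOp_apply]
  have h : ∀ s s' : Bool, Function.update (Function.update (Function.update
      (Function.update σ a s) b s') a false) b true =
      Function.update (Function.update σ a false) b true := by
    intro s s'; funext x; simp only [Function.update_apply]; split_ifs <;> rfl
  have h' : ∀ s s' : Bool, Function.update (Function.update (Function.update
      (Function.update σ a s) b s') a true) b false =
      Function.update (Function.update σ a true) b false := by
    intro s s'; funext x; simp only [Function.update_apply]; split_ifs <;> rfl
  simp only [h, h', Function.update_self, Function.update_of_ne hab, cupCoeff]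
  simp only [reduceCtorEq, if_false, if_true, Bool.false_eq_true]
  ring

lemma spinOp_comm {a b c d : X} (hac : a ≠ c) (had : a ≠ d) (hbc : b ≠ c) (hbd : b ≠ d) :
    spinOp q q' a b * spinOp q q' c d = spinOp q q' c d * spinOp q q' a b := by
  refine LinearMap.ext fun f => funext fun σ => ?_
  simp only [Module.End.mul_apply, spinOp_apply]
  simp only [Function.update_of_ne hac, Function.update_of_ne had, Function.update_of_ne hbc,
    Function.update_of_ne hbd, Function.update_of_ne hac.symm, Function.update_of_ne had.symm,
    Function.update_of_ne hbc.symm, Function.update_of_ne hbd.symm]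
  have h : ∀ s s' u u' : Bool, Function.update (Function.update (Function.update
      (Function.update σ a s) b s') c u) d u' =
      Function.update (Function.update (Function.update (Function.update σ c u) d u') a s) b s' := by
    intro s s' u u'; funext x; simp only [Function.update_apply]; split_ifs <;> simp_all
  simp only [h]
  ring

/-- A spin that runs along the zigzag of a cup and a cap picks up 1 or `q * q'`, according to its
value. -/
lemma spinOp_adj (hq : q * q' = 1) {a b c : X} (hab : a ≠ b) (hac : a ≠ c) (hbc : b ≠ c) :
    spinOp q q' a b * spinOp q q' b c * spinOp q q' a b = spinOp q q' a b ∧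
    spinOp q q' b c * spinOp q q' a b * spinOp q q' b c = spinOp q q' b c := by
  have hqq : ∀ y, q * (q' * y) = y := fun y => by rw [← mul_assoc, hq, one_mul]
  constructor
  all_goals
    refine LinearMap.ext fun f => funext fun σ => ?_
    simp only [Module.End.mul_apply, spinOp_apply]
    simp only [Function.update_of_ne hac, Function.update_of_ne hab, Function.update_of_ne hbc,
      Function.update_of_ne hac.symm, Function.update_of_ne hbc.symm, Function.update_self]
    have h1 : ∀ s s' u u' v v' : Bool, Function.update (Function.update (Function.update
        (Function.update (Function.update (Function.update σ a s) b s') b u) c u') a v) b v' =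
        Function.update (Function.update (Function.update σ a v) b v') c u' :=
      fun s s' u u' v v' => update_three hac hbc σ s s' u u' v v'
    have h2 : ∀ s s' u u' v v' : Bool, Function.update (Function.update (Function.update
        (Function.update (Function.update (Function.update σ b s) c s') a u) b u') b v) c v' =
        Function.update (Function.update (Function.update σ b v) c v') a u :=
      fun s s' u u' v v' => update_three' hab hac σ s s' u u' v v'
    have h3 : ∀ s s' u, σ c = u → Function.update (Function.update (Function.update σ a s) b s') c u
        = Function.update (Function.update σ a s) b s' := by
      rintro s s' _ rfl
      rw [Function.update_comm hbc, Function.update_comm hac, Function.update_eq_self]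
    have h4 : ∀ s s' u, σ a = u → Function.update (Function.update (Function.update σ b s) c s') a u
        = Function.update (Function.update σ b s) c s' := by
      rintro s s' _ rfl
      rw [Function.update_comm hac.symm, Function.update_comm hab.symm, Function.update_eq_self]
    simp only [h1, h2]
    rcases ha : σ a <;> rcases hb : σ b <;> rcases hc : σ c <;>
    simp only [cupCoeff, reduceCtorEq, if_false, if_true, Bool.false_eq_true, h3 _ _ _ hc,
      h4 _ _ _ ha, mul_zero, zero_mul, add_zero, zero_add, one_mul, hqq]

end Spin

/-! ### Matrices of contractions and the twisted trace -/

section SpinMatrix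

variable {X : Type*} [DecidableEq X] [Fintype X] {R : Type*} [CommRing R] (q q' z z' : R)

/-- The matrix of the contraction of the sites `a` and `b`. -/
def spinMatrix (a b : X) : Matrix (X → Bool) (X → Bool) R :=
  LinearMap.toMatrixAlgEquiv' (spinOp q q' a b)

/-- The diagonal entry of a contraction on a pair of neighbouring spins. -/
def bondCoeff (s s' : Bool) : R := if s = s' then 0 else if s then q' else q

/-- The weight `z` or `z'` of a single spin. -/
def siteWeight (s : Bool) : R := if s then z' else z

/-- The trace on the spin chain, twisted by the weight of the configuration. -/
def twistedTrace : Matrix (X → Bool) (X → Bool) R →ₗ[R] R where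
  toFun M := (M * Matrix.diagonal fun σ : X → Bool => ∏ k, siteWeight z z' (σ k)).trace
  map_add' M M' := by rw [add_mul, Matrix.trace_add]
  map_smul' c M := by rw [Matrix.smul_mul, Matrix.trace_smul, RingHom.id_apply]

variable {q q' z z'}

lemma twistedTrace_apply (M : Matrix (X → Bool) (X → Bool) R) :
    twistedTrace z z' M = ∑ σ, M σ σ * ∏ k, siteWeight z z' (σ k) := by
  simp [twistedTrace, Matrix.trace, Matrix.mul_diagonal]

lemma spinMatrix_apply (a b : X) (σ τ : X → Bool) : spinMatrix q q' a b σ τ =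
    cupCoeff q' (σ a) (σ b) *
      (q * (if Function.update (Function.update σ a false) b true = τ then 1 else 0) +
        (if Function.update (Function.update σ a true) b false = τ then 1 else 0)) := by
  rw [spinMatrix, LinearMap.toMatrixAlgEquiv'_apply, spinOp_apply]
  simp only [Pi.single_apply]

lemma of_spinMatrix_ne_zero {a b : X} (hab : a ≠ b) {σ τ : X → Bool}
    (h : spinMatrix q q' a b σ τ ≠ 0) :
    (∀ k, k ≠ a → k ≠ b → σ k = τ k) ∧ σ a ≠ σ b ∧ τ a ≠ τ b := by
  rw [spinMatrix_apply] at h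
  have h1 := left_ne_zero_of_mul h
  have h2 := right_ne_zero_of_mul h
  have h3 : σ a ≠ σ b := fun h => h1 (by simp [cupCoeff, h])
  by_cases h4 : Function.update (Function.update σ a false) b true = τ
  · subst h4
    exact ⟨fun k hka hkb => by simp [hka, hkb], h3, by simp [hab]⟩
  by_cases h5 : Function.update (Function.update σ a true) b false = τ
  · subst h5
    exact ⟨fun k hka hkb => by simp [hka, hkb], h3, by simp [hab]⟩
  · simp [h4, h5] at h2

lemma spinMatrix_self {a b : X} (hab : a ≠ b) (σ : X → Bool) :
    spinMatrix q q' a b σ σ = bondCoeff q q' (σ a) (σ b) := by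
  have h : ∀ s s' : Bool, Function.update (Function.update σ a s) b s' = σ ↔
      s = σ a ∧ s' = σ b := by
    intro s s'
    rw [Function.update_eq_iff]
    constructor
    · rintro ⟨rfl, h⟩
      exact ⟨by simpa using h a hab, rfl⟩
    · rintro ⟨rfl, rfl⟩
      exact ⟨rfl, fun x hx => by simp⟩
  rw [spinMatrix_apply]
  simp only [h]
  rcases σ a <;> rcases σ b <;> simp [cupCoeff, bondCoeff]

/-- A contraction only links configurations with opposite spins at a and b that agree elsewhere; the
pair has weight `z * z'` on both sides. -/
lemma commute_spinMatrix_weight {a b : X} (hab : a ≠ b) :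
    Commute (spinMatrix q q' a b)
      (Matrix.diagonal fun σ : X → Bool => ∏ k, siteWeight z z' (σ k)) := by
  ext σ τ
  rw [Matrix.mul_diagonal, Matrix.diagonal_mul, mul_comm]
  by_cases h : spinMatrix q q' a b σ τ = 0
  · rw [h, mul_zero, mul_zero]
  obtain ⟨h1, h2, h3⟩ := of_spinMatrix_ne_zero hab h
  congr 1
  have hb : b ∈ Finset.univ.erase a := by simp [hab.symm]
  rw [← Finset.mul_prod_erase _ _ (Finset.mem_univ a), ← Finset.mul_prod_erase _ _ hb,
    ← Finset.mul_prod_erase _ (fun k => siteWeight z z' (σ k)) (Finset.mem_univ a),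
    ← Finset.mul_prod_erase _ (fun k => siteWeight z z' (σ k)) hb, ← mul_assoc, ← mul_assoc]
  congr 1
  · revert h2 h3
    rcases σ a <;> rcases σ b <;> rcases τ a <;> rcases τ b <;> simp [siteWeight, mul_comm]
  · refine Finset.prod_congr rfl fun k hk => ?_
    simp only [Finset.mem_erase] at hk
    rw [h1 k hk.2.1 hk.1]

end SpinMatrix

/-! ### Transfer computation of the twisted trace on words -/

section Chain

variable {R : Type*} [CommRing R] (q q' z z' : R)

/-- The contraction of the sites `i` and `i + 1` on a chain of `N + 1` sites. -/
def chainMatrix (N i : ℕ) : Matrix (Fin (N + 1) → Bool) (Fin (N + 1) → Bool) R :=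
  spinMatrix q q' (Fin.ofNat (N + 1) i) (Fin.ofNat (N + 1) (i + 1))

variable {q q' z z'} {N : ℕ}

lemma ofNat_ne {i j : ℕ} (hi : i ≤ N) (hj : j ≤ N) (hij : i ≠ j) :
    Fin.ofNat (N + 1) i ≠ Fin.ofNat (N + 1) j := by
  intro h
  have := congrArg Fin.val h
  simp only [Fin.val_ofNat, Nat.mod_eq_of_lt (Nat.lt_succ_of_le hi),
    Nat.mod_eq_of_lt (Nat.lt_succ_of_le hj)] at this
  exact hij this

lemma chainMatrix_sq {i : ℕ} (hi : i < N) :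
    chainMatrix q q' N i * chainMatrix q q' N i = (q + q') • chainMatrix q q' N i := by
  rw [chainMatrix, spinMatrix, ← map_mul, spinOp_sq (ofNat_ne (by omega) (by omega) (by omega)),
    map_smul]

lemma chainMatrix_adj (hq : q * q' = 1) {i : ℕ} (hi : i + 1 < N) :
    chainMatrix q q' N i * chainMatrix q q' N (i + 1) * chainMatrix q q' N i =
      chainMatrix q q' N i ∧
    chainMatrix q q' N (i + 1) * chainMatrix q q' N i * chainMatrix q q' N (i + 1) =
      chainMatrix q q' N (i + 1) := by
  have h := spinOp_adj hq (ofNat_ne (N := N) (i := i) (j := i + 1) (by omega) (by omega) (by omega))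
    (ofNat_ne (N := N) (i := i) (j := i + 1 + 1) (by omega) (by omega) (by omega))
    (ofNat_ne (N := N) (i := i + 1) (j := i + 1 + 1) (by omega) (by omega) (by omega))
  simp only [chainMatrix, spinMatrix, ← map_mul]
  exact ⟨congrArg _ h.1, congrArg _ h.2⟩

lemma chainMatrix_comm {i j : ℕ} (hij : i + 1 < j) (hj : j < N) :
    chainMatrix q q' N i * chainMatrix q q' N j =
      chainMatrix q q' N j * chainMatrix q q' N i := by
  simp only [chainMatrix, spinMatrix, ← map_mul]
  rw [spinOp_comm] <;> exact ofNat_ne (by omega) (by omega) (by omega)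

/-- The first k letters act on the sites 0, …, k only. -/
lemma chain_word_eq_zero (S : Finset ℕ) {k : ℕ} (hk : k ≤ N) {σ τ : Fin (N + 1) → Bool}
    (h : word (chainMatrix q q' N) S 0 k σ τ ≠ 0) (p : Fin (N + 1)) (hp : k < p.val) :
    σ p = τ p := by
  induction k generalizing τ with
  | zero =>
    rw [word_zero, Matrix.one_apply] at h
    by_contra h'
    exact h (if_neg fun h'' => h' (by rw [h'']))
  | succ k ih =>
    rw [word_succ, Matrix.mul_apply] at h
    obtain ⟨ρ, -, hρ⟩ := Finset.exists_ne_zero_of_sum_ne_zero h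
    rw [ih (by omega) (left_ne_zero_of_mul hρ) (by omega)]
    have h2 := right_ne_zero_of_mul hρ
    split_ifs at h2 with hS
    · refine (of_spinMatrix_ne_zero (ofNat_ne (by omega) (by omega) (by omega)) h2).1 p ?_ ?_ <;>
      · rintro rfl
        rw [Fin.val_ofNat, Nat.mod_eq_of_lt (by omega)] at hp
        omega
    · rw [Matrix.one_apply] at h2
      by_contra h'
      exact h2 (if_neg fun h'' => h' (by rw [h'']))

/-- Only the constant path contributes to a diagonal entry. Before letter k acts, site k + 1 is
untouched and already has its final value; opposite spins before and after then force site k to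
agree too. -/
lemma chain_word_self (S : Finset ℕ) {k : ℕ} (hk : k ≤ N)
    (σ : Fin (N + 1) → Bool) :
    word (chainMatrix q q' N) S 0 k σ σ = ∏ i ∈ Finset.range k, if i ∈ S then
      bondCoeff q q' (σ (Fin.ofNat (N + 1) i)) (σ (Fin.ofNat (N + 1) (i + 1))) else 1 := by
  induction k with
  | zero => simp
  | succ k ih =>
    rw [word_succ, Finset.prod_range_succ, ← ih (by omega), zero_add]
    split_ifs with hS
    · rw [Matrix.mul_apply, Finset.sum_eq_single σ]
      · rw [← spinMatrix_self (ofNat_ne (by omega) (by omega) (by omega))]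
        rfl
      · intro τ _ hτ
        by_contra h
        have h1 := chain_word_eq_zero S (by omega) (left_ne_zero_of_mul h)
        obtain ⟨h2, h3, h4⟩ := of_spinMatrix_ne_zero (ofNat_ne (by omega) (by omega) (by omega))
          (right_ne_zero_of_mul h)
        have h5 := h1 (Fin.ofNat (N + 1) (k + 1))
          (by rw [Fin.val_ofNat, Nat.mod_eq_of_lt (by omega)]; omega)
        refine hτ (funext fun p => ?_)
        by_cases hp1 : p = Fin.ofNat (N + 1) (k + 1)
        · rw [hp1, h5]
        · by_cases hp2 : p = Fin.ofNat (N + 1) k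
          · rw [hp2]
            rw [← h5] at h3
            revert h3 h4
            rw [h5]
            generalize τ (Fin.ofNat (N + 1) k) = x
            generalize σ (Fin.ofNat (N + 1) k) = y
            generalize τ (Fin.ofNat (N + 1) (k + 1)) = w
            revert x y w
            decide
          · exact h2 p hp2 hp1
      · simp
    · simp

/-- The partition function of a chain of `N + 1` spins whose first spin is `b`. -/
def chainSum (z z' : R) (N : ℕ) (c : ℕ → Bool → Bool → R) (b : Bool) : R :=
  ∑ τ : Fin N → Bool, (∏ i : Fin N, c i ((Fin.cons b τ : Fin (N + 1) → Bool) i.castSucc) (τ i)) *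
    ∏ k : Fin (N + 1), siteWeight z z' ((Fin.cons b τ : Fin (N + 1) → Bool) k)

lemma chainSum_zero (c : ℕ → Bool → Bool → R) (b : Bool) :
    chainSum z z' 0 c b = siteWeight z z' b := by
  simp [chainSum]

lemma chainSum_succ (N : ℕ) (c : ℕ → Bool → Bool → R) (b : Bool) :
    chainSum z z' (N + 1) c b = siteWeight z z' b *
      ∑ b', c 0 b b' * chainSum z z' N (fun i => c (i + 1)) b' := by
  rw [chainSum, ← (Fin.consEquiv fun _ : Fin (N + 1) => Bool).sum_comp, Fintype.sum_prod_type,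
    Finset.mul_sum]
  refine Finset.sum_congr rfl fun b' _ => ?_
  rw [chainSum, Finset.mul_sum, Finset.mul_sum]
  refine Finset.sum_congr rfl fun τ _ => ?_
  rw [Fin.prod_univ_succ, Fin.prod_univ_succ (n := N + 1)]
  simp only [Fin.consEquiv_apply, Fin.castSucc_zero, Fin.cons_zero, Fin.cons_succ, Fin.val_zero,
    Fin.val_succ, ← Fin.succ_castSucc]
  ring

/-- The bond weights of the product of the first `l` contractions. -/
def initialBond (q q' : R) (l : ℕ) (i : ℕ) (s s' : Bool) : R :=
  if i < l then bondCoeff q q' s s' else 1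

lemma chainSum_initialBond_zero (N : ℕ) (b : Bool) :
    chainSum z z' N (initialBond q q' 0) b = siteWeight z z' b * (z + z') ^ N := by
  induction N generalizing b with
  | zero => simp [chainSum_zero]
  | succ N ih =>
    rw [chainSum_succ]
    have : (fun i => initialBond q q' 0 (i + 1)) = initialBond q q' 0 := by
      funext i s s'; simp [initialBond]
    rw [this]
    simp only [ih, Fintype.sum_bool, initialBond, lt_irrefl, if_false, siteWeight, if_true,
      Bool.false_eq_true]
    ring

lemma chainSum_initialBond_succ (N l : ℕ) (b : Bool) :
    chainSum z z' (N + 1) (initialBond q q' (l + 1)) b = siteWeight z z' b *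
      (bondCoeff q q' b (!b) * chainSum z z' N (initialBond q q' l) (!b)) := by
  rw [chainSum_succ]
  have : (fun i => initialBond q q' (l + 1) (i + 1)) = initialBond q q' l := by
    funext i s s'; simp [initialBond]
  rw [this]
  cases b <;> simp [initialBond, bondCoeff]

/-- Spins alternate along the block, so two successive bonds contribute `q * q'` and two successive
spins `z * z'`; pairs of sites drop out until the block is gone. -/
lemma chainSum_initialBond_even (hq : q * q' = 1) (hz : z * z' = 1) (j N : ℕ) (b : Bool) :
    chainSum z z' (N + 2 * j) (initialBond q q' (2 * j)) b =
      siteWeight z z' b * (z + z') ^ N := by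
  induction j with
  | zero => exact chainSum_initialBond_zero N b
  | succ j ih =>
    rw [show N + 2 * (j + 1) = N + 2 * j + 1 + 1 by ring, show 2 * (j + 1) = 2 * j + 1 + 1 by ring,
      chainSum_initialBond_succ, chainSum_initialBond_succ, Bool.not_not, ih]
    have hq' : q' * q = 1 := by rw [mul_comm, hq]
    cases b
    · simp only [siteWeight, bondCoeff, Bool.not_false, if_true, if_false, Bool.false_eq_true,
        reduceCtorEq]
      linear_combination (z * z' * z * (z + z') ^ N) * hq + (z * (z + z') ^ N) * hz
    · simp only [siteWeight, bondCoeff, Bool.not_true, if_true, if_false, Bool.false_eq_true,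
        reduceCtorEq]
      linear_combination (z * z' * z' * (z + z') ^ N) * hq + (z' * (z + z') ^ N) * hz

lemma chainSum_initialBond_odd (hq : q * q' = 1) (hz : z * z' = 1) (j N : ℕ) (b : Bool) :
    chainSum z z' (N + 2 * j + 1) (initialBond q q' (2 * j + 1)) b =
      bondCoeff q q' b (!b) * (z + z') ^ N := by
  rw [chainSum_initialBond_succ, chainSum_initialBond_even hq hz]
  cases b <;> simp only [siteWeight, Bool.not_false, Bool.not_true, if_true, if_false,
    Bool.false_eq_true] <;>
  linear_combination (bondCoeff q q' _ _ * (z + z') ^ N) * hz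

lemma twistedTrace_word (l : ℕ) :
    twistedTrace z z' (word (chainMatrix q q' N) (Finset.range l) 0 N) =
      ∑ b, chainSum z z' N (initialBond q q' l) b := by
  rw [twistedTrace_apply, ← (Fin.consEquiv fun _ : Fin (N + 1) => Bool).sum_comp,
    Fintype.sum_prod_type]
  refine Finset.sum_congr rfl fun b _ => ?_
  rw [chainSum]
  refine Finset.sum_congr rfl fun τ _ => ?_
  rw [chain_word_self _ le_rfl, Finset.prod_range]
  congr 1
  refine Finset.prod_congr rfl fun i _ => ?_
  have h1 : Fin.ofNat (N + 1) i = i.castSucc := by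
    ext; simp
  have h2 : Fin.ofNat (N + 1) (i + 1) = i.succ := by
    ext; simp
  rw [h1, h2]
  simp [initialBond]

/-- The value of the twisted trace on an even initial block with free strands. -/
lemma twistedTrace_word_even (hq : q * q' = 1) (hz : z * z' = 1) {j : ℕ} (hj : 2 * j ≤ N) :
    twistedTrace z z' (word (chainMatrix q q' N) (Finset.range (2 * j)) 0 N) =
      (z + z') ^ (N + 1 - 2 * j) := by
  obtain ⟨M, rfl⟩ : ∃ M, N = M + 2 * j := ⟨N - 2 * j, by omega⟩
  rw [twistedTrace_word, Fintype.sum_bool, chainSum_initialBond_even hq hz,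
    chainSum_initialBond_even hq hz, show M + 2 * j + 1 - 2 * j = M + 1 by omega]
  simp [siteWeight]
  ring

/-- The value of the twisted trace on the product of all generators for an even number of
strands. -/
lemma twistedTrace_word_full (hq : q * q' = 1) (hz : z * z' = 1) {j : ℕ} (hj : 2 * j = N + 1) :
    twistedTrace z z' (word (chainMatrix q q' N) (Finset.range (2 * j)) 0 N) = q + q' := by
  obtain ⟨k, rfl⟩ : ∃ k, N = 2 * k + 1 := ⟨j - 1, by omega⟩
  -- There are only 2k + 1 letters, so the block is odd here and no spin remains free.
  rw [word_congr (T := Finset.range (2 * k + 1)) fun i _ hi => by simp; omega,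
    twistedTrace_word, Fintype.sum_bool]
  have h := chainSum_initialBond_odd hq hz k 0
  rw [zero_add] at h
  rw [h, h]
  simp [bondCoeff]
  ring

end Chain

/-! ### Traces on products of matrix algebras -/

section MatrixTraces

lemma IsBasisOf.map {V V' : Type*} [AddCommGroup V] [Module ℂ V] [AddCommGroup V'] [Module ℂ V']
    {S : Set V} {W : Submodule ℂ V} (h : IsBasisOf S W) {f : V →ₗ[ℂ] V'}
    (hf : Function.Injective f) : IsBasisOf (f '' S) (W.map f) := by
  refine ⟨?_, by rw [Submodule.span_image, h.2]⟩
  have h1 : LinearIndepOn ℂ (f ∘ id) S := LinearIndependent.map' h.1 f (LinearMap.ker_eq_bot.2 hf)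
  exact h1.id_image

/-- Up to a scalar, the trace is the only trace functional on a matrix algebra. -/
lemma trace_matrix_unique {d : ℕ} [NeZero d] (t : Matrix (Fin d) (Fin d) ℂ →ₗ[ℂ] ℂ)
    (ht : t ∈ traceSpace (Matrix (Fin d) (Fin d) ℂ)) (x : Matrix (Fin d) (Fin d) ℂ) :
    t x = t (Matrix.single 0 0 1) * x.trace := by
  have ht : ∀ x y, t (x * y) = t (y * x) := ht
  have h1 : ∀ i j, i ≠ j → t (Matrix.single i j 1) = 0 := by
    intro i j hij
    have := ht (Matrix.single i i 1) (Matrix.single i j 1)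
    rwa [Matrix.single_mul_single_same, Matrix.single_mul_single_of_ne _ _ _ _ hij.symm, map_zero,
      mul_one] at this
  have h2 : ∀ i, t (Matrix.single i i 1) = t (Matrix.single 0 0 1) := by
    intro i
    have := ht (Matrix.single i 0 1) (Matrix.single 0 i 1)
    rwa [Matrix.single_mul_single_same, Matrix.single_mul_single_same, mul_one] at this
  conv_lhs => rw [Matrix.matrix_eq_sum_single x]
  rw [map_sum, Matrix.trace, Finset.mul_sum]
  refine Finset.sum_congr rfl fun i _ => ?_
  have h3 : ∀ j, Matrix.single i j (x i j) = x i j • Matrix.single i j (1 : ℂ) := by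
    intro j; rw [Matrix.smul_single, smul_eq_mul, mul_one]
  rw [map_sum, Finset.sum_eq_single i]
  · rw [h3, map_smul, h2, smul_eq_mul, Matrix.diag_apply, mul_comm]
  · intro j _ hj
    rw [h3, map_smul, h1 i j hj.symm, smul_zero]
  · simp

variable {m : ℕ} {d : Fin m → ℕ}

/-- The trace of the `i`-th factor of a product of matrix algebras. -/
def factorTrace (d : Fin m → ℕ) (i : Fin m) : (Π i, Matrix (Fin (d i)) (Fin (d i)) ℂ) →ₗ[ℂ] ℂ :=
  (Matrix.traceLinearMap (Fin (d i)) ℂ ℂ).comp (LinearMap.proj i)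

lemma factorTrace_apply (i : Fin m) (x : Π i, Matrix (Fin (d i)) (Fin (d i)) ℂ) :
    factorTrace d i x = (x i).trace := rfl

lemma factorTrace_mem (i : Fin m) : factorTrace d i ∈ traceSpace _ :=
  fun a b => Matrix.trace_mul_comm (a i) (b i)

variable [∀ i, NeZero (d i)]

/-- Some central idempotent `Pi.single i 1` has nonzero image. The image is central, hence scalar,
and idempotent, hence 1, so `ρ` factors through the simple factor i as an isomorphism. Uniqueness of
the trace up to scalars, normalised at the identity, finishes. -/
lemma exists_eq_factorTrace {k : ℕ} (hk : 0 < k)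
    (ρ : (Π i, Matrix (Fin (d i)) (Fin (d i)) ℂ) →ₐ[ℂ] Matrix (Fin k) (Fin k) ℂ)
    (hρ : Function.Surjective ρ) :
    ∃ i, (Matrix.traceLinearMap (Fin k) ℂ ℂ).comp ρ.toLinearMap = factorTrace d i := by
  have : NeZero k := ⟨hk.ne'⟩
  let c : Fin m → Π i, Matrix (Fin (d i)) (Fin (d i)) ℂ := fun i => Pi.single i 1
  obtain ⟨i, hi⟩ : ∃ i, ρ (c i) ≠ 0 := by
    by_contra! h
    have h1 : ρ (∑ i, c i) = 1 := by
      rw [show ∑ i, c i = 1 from Finset.univ_sum_single 1, map_one]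
    rw [map_sum, Finset.sum_eq_zero fun i _ => h i] at h1
    exact zero_ne_one h1
  have hcen : ∀ x, x * c i = Pi.single i (x i) := by
    intro x
    funext j
    rcases eq_or_ne j i with rfl | h
    · simp [c]
    · simp [c, h]
  have hcen' : ∀ x, c i * x = Pi.single i (x i) := by
    intro x
    funext j
    rcases eq_or_ne j i with rfl | h
    · simp [c]
    · simp [c, h]
  obtain ⟨s, hs⟩ : ρ (c i) ∈ Set.range (Matrix.scalar (Fin k)) := by
    refine Matrix.mem_range_scalar_of_commute_single fun a b _ => ?_
    obtain ⟨x, hx⟩ := hρ (Matrix.single a b 1)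
    rw [← hx, Commute, SemiconjBy, ← map_mul, ← map_mul, hcen, hcen']
  have hone : ρ (c i) = 1 := by
    have h1 : ρ (c i) * ρ (c i) = ρ (c i) := by
      rw [← map_mul, hcen]; simp [c]
    have h2 : s ≠ 0 := by rintro rfl; exact hi (by rw [← hs, map_zero])
    rw [← hs, ← map_mul] at h1
    have h3 : s * s = s := Matrix.scalar_inj.1 h1
    rw [← hs, show s = 1 from mul_right_cancel₀ h2 (by rw [h3, one_mul]), map_one]
  have hfac : ∀ x, ρ x = ρ (Pi.single i (x i)) := by
    intro x; rw [← hcen, map_mul, hone, mul_one]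
  let φ : Matrix (Fin (d i)) (Fin (d i)) ℂ →ₐ[ℂ] Matrix (Fin k) (Fin k) ℂ :=
    AlgHom.ofLinearMap (ρ.toLinearMap.comp
      (LinearMap.single ℂ (fun i => Matrix (Fin (d i)) (Fin (d i)) ℂ) i)) hone fun x y => by
      change ρ (Pi.single i (x * y)) = ρ (Pi.single i x) * ρ (Pi.single i y)
      rw [← map_mul, Pi.single_mul]
  have hφ : ∀ x, φ x = ρ (Pi.single i x) := fun x => rfl
  have hbij : Function.Bijective φ := by
    refine ⟨RingHom.injective φ.toRingHom, fun y => ?_⟩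
    obtain ⟨x, rfl⟩ := hρ y
    exact ⟨x i, by rw [hφ, hfac x]⟩
  have hdim : d i = k := by
    have := (LinearEquiv.ofBijective φ.toLinearMap hbij).finrank_eq
    simp only [Module.finrank_matrix, Fintype.card_fin, Module.finrank_self, mul_one] at this
    exact Nat.mul_self_inj.1 this
  have htr := trace_matrix_unique ((Matrix.traceLinearMap (Fin k) ℂ ℂ).comp φ.toLinearMap)
    fun x y => by simp [Matrix.trace_mul_comm (φ x)]
  have hconst := htr 1
  simp only [LinearMap.comp_apply, AlgHom.toLinearMap_apply, map_one, Matrix.traceLinearMap_apply,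
    Matrix.trace_one, Fintype.card_fin, hdim] at hconst
  have hk' : (k : ℂ) ≠ 0 := Nat.cast_ne_zero.2 hk.ne'
  refine ⟨i, LinearMap.ext fun x => ?_⟩
  have h1 := htr (x i)
  simp only [LinearMap.comp_apply, AlgHom.toLinearMap_apply, Matrix.traceLinearMap_apply, hφ,
    ← hfac x] at h1
  simp only [LinearMap.comp_apply, AlgHom.toLinearMap_apply, Matrix.traceLinearMap_apply, h1,
    factorTrace_apply]
  rw [hφ] at hconst
  rw [mul_right_cancel₀ hk' (hconst.symm.trans (one_mul _).symm), one_mul]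

lemma matrixTraces_pi :
    matrixTraces (Π i, Matrix (Fin (d i)) (Fin (d i)) ℂ) = Set.range (factorTrace d) := by
  ext t
  constructor
  · rintro ⟨k, ρ, hk, hρ, rfl⟩
    obtain ⟨i, hi⟩ := exists_eq_factorTrace hk ρ hρ
    exact ⟨i, hi.symm⟩
  · rintro ⟨i, rfl⟩
    exact ⟨d i, Pi.evalAlgHom ℂ _ i, Nat.pos_of_ne_zero (NeZero.ne _),
      Function.surjective_eval i, rfl⟩

lemma factorTrace_single (i j : Fin m) :
    factorTrace d i (Pi.single j (Matrix.single 0 0 1)) = if i = j then 1 else 0 := by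
  rw [factorTrace_apply]
  split_ifs with h
  · subst h; simp
  · rw [Pi.single_eq_of_ne h, Matrix.trace_zero]

lemma isBasisOf_matrixTraces_pi :
    IsBasisOf (matrixTraces (Π i, Matrix (Fin (d i)) (Fin (d i)) ℂ)) (traceSpace _) := by
  rw [matrixTraces_pi]
  constructor
  · refine LinearIndependent.linearIndepOn_id ?_
    rw [Fintype.linearIndependent_iff]
    intro g hg j
    have := congrArg (fun t => t (Pi.single j (Matrix.single 0 0 1))) hg
    simpa [factorTrace_single] using this
  · refine le_antisymm (Submodule.span_le.2 ?_) fun t ht => ?_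
    · rintro _ ⟨i, rfl⟩
      exact factorTrace_mem i
    · have : t = ∑ i, t (Pi.single i (Matrix.single 0 0 1)) • factorTrace d i := by
        refine LinearMap.ext fun x => ?_
        conv_lhs => rw [← Finset.univ_sum_single x]
        rw [map_sum, LinearMap.sum_apply]
        refine Finset.sum_congr rfl fun i _ => ?_
        have := trace_matrix_unique (t.comp
          (LinearMap.single ℂ (fun i => Matrix (Fin (d i)) (Fin (d i)) ℂ) i)) (fun x y => by
          simp only [LinearMap.comp_apply, LinearMap.single_apply, Pi.single_mul]
          exact ht _ _) (x i)
        simpa [factorTrace_apply] using this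
      rw [this]
      exact Submodule.sum_mem _ fun i _ =>
        Submodule.smul_mem _ _ (Submodule.subset_span ⟨i, rfl⟩)

end MatrixTraces

/-! ### Wedderburn decomposition and traces that vanish on the radical -/

section Semisimple

lemma isBasisOf_matrixTraces (B : Type*) [Ring B] [Algebra ℂ B] [IsSemisimpleRing B]
    [FiniteDimensional ℂ B] : IsBasisOf (matrixTraces B) (traceSpace B) := by
  obtain ⟨m, d, hd, ⟨φ⟩⟩ := IsSemisimpleRing.exists_algEquiv_pi_matrix_of_isAlgClosed ℂ B
  have h := (isBasisOf_matrixTraces_pi (d := d)).map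
    (f := LinearMap.lcomp ℂ ℂ φ.toLinearMap) fun s t hst => by
      refine LinearMap.ext fun x => ?_
      have := LinearMap.congr_fun hst (φ.symm x)
      simpa using this
  convert h using 1
  · ext t
    constructor
    · rintro ⟨k, ρ, hk, hρ, rfl⟩
      refine ⟨_, ⟨k, ρ.comp φ.symm.toAlgHom, hk, hρ.comp φ.symm.surjective, rfl⟩, ?_⟩
      refine LinearMap.ext fun x => ?_
      simp
    · rintro ⟨_, ⟨k, ρ, hk, hρ, rfl⟩, rfl⟩
      exact ⟨k, ρ.comp φ.toAlgHom, hk, hρ.comp φ.surjective, LinearMap.ext fun x => rfl⟩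
  · ext t
    constructor
    · intro ht
      refine ⟨t.comp φ.symm.toLinearMap, fun a b => ?_, LinearMap.ext fun x => by simp⟩
      simpa using ht (φ.symm a) (φ.symm b)
    · rintro ⟨s, hs, rfl⟩ a b
      simpa using hs (φ a) (φ b)

lemma exists_comp_eq_of_surjective {V W : Type*} [AddCommGroup V] [Module ℂ V] [AddCommGroup W]
    [Module ℂ W] {f : V →ₗ[ℂ] W} (hf : Function.Surjective f) (t : V →ₗ[ℂ] ℂ)
    (h : ∀ x, f x = 0 → t x = 0) : ∃ s : W →ₗ[ℂ] ℂ, s.comp f = t := by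
  refine ⟨((LinearMap.ker f).liftQ t h).comp (f.quotKerEquivOfSurjective hf).symm.toLinearMap,
    LinearMap.ext fun x => ?_⟩
  have : (f.quotKerEquivOfSurjective hf).symm (f x) = Submodule.Quotient.mk x := by
    rw [LinearEquiv.symm_apply_eq]; rfl
  simp only [LinearMap.comp_apply, LinearEquiv.coe_coe, this]
  rfl

/-- The traces that vanish on the Jacobson radical. -/
def radicalTraces (A : Type*) [Ring A] [Algebra ℂ A] : Submodule ℂ (A →ₗ[ℂ] ℂ) where
  carrier := {t | t ∈ traceSpace A ∧ ∀ x ∈ Ring.jacobson A, t x = 0}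
  add_mem' hs ht := ⟨add_mem hs.1 ht.1, fun x hx => by simp [hs.2 x hx, ht.2 x hx]⟩
  zero_mem' := ⟨zero_mem _, fun x _ => rfl⟩
  smul_mem' c t ht := ⟨Submodule.smul_mem _ c ht.1, fun x hx => by simp [ht.2 x hx]⟩

/-- The matrix traces of the semisimple quotient are a basis of the traces that vanish on the
Jacobson radical. -/
lemma isBasisOf_semisimpleMatrixTraces (A : Type*) [Ring A] [Algebra ℂ A] [FiniteDimensional ℂ A] :
    IsBasisOf (semisimpleMatrixTraces A) (radicalTraces A) := by
  have : IsArtinianRing A := IsArtinianRing.of_finite ℂ A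
  have : IsSemisimpleRing (Semisimplification A) := IsSemiprimaryRing.isSemisimpleRing
  have hfin : FiniteDimensional ℂ (Semisimplification A) :=
    Module.Finite.of_surjective (Ideal.Quotient.mkₐ ℂ (Ring.jacobson A)).toLinearMap
      (Ideal.Quotient.mkₐ_surjective ℂ _)
  have hsurj := Ideal.Quotient.mkₐ_surjective ℂ (Ring.jacobson A)
  have h := (isBasisOf_matrixTraces (Semisimplification A)).map
    (f := LinearMap.lcomp ℂ ℂ (Ideal.Quotient.mkₐ ℂ (Ring.jacobson A)).toLinearMap)
    fun s t hst => by
      refine LinearMap.ext fun x => ?_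
      obtain ⟨x, rfl⟩ := hsurj x
      exact LinearMap.congr_fun hst x
  have h2 : radicalTraces A = (traceSpace (Semisimplification A)).map
      (LinearMap.lcomp ℂ ℂ (Ideal.Quotient.mkₐ ℂ (Ring.jacobson A)).toLinearMap) := by
    ext t
    constructor
    · rintro ⟨ht, hJ⟩
      obtain ⟨s, rfl⟩ := exists_comp_eq_of_surjective
        (f := (Ideal.Quotient.mkₐ ℂ (Ring.jacobson A)).toLinearMap) hsurj t
        fun x hx => hJ x (Ideal.Quotient.eq_zero_iff_mem.1 hx)
      refine ⟨s, fun a b => ?_, rfl⟩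
      obtain ⟨a, rfl⟩ := hsurj a
      obtain ⟨b, rfl⟩ := hsurj b
      rw [← map_mul, ← map_mul]
      exact ht a b
    · rintro ⟨s, hs, rfl⟩
      refine ⟨fun a b => ?_, fun x hx => ?_⟩
      · have := hs (Ideal.Quotient.mkₐ ℂ (Ring.jacobson A) a) (Ideal.Quotient.mkₐ ℂ _ b)
        rw [← map_mul, ← map_mul] at this
        exact this
      · change s (Ideal.Quotient.mk _ x) = 0
        rw [Ideal.Quotient.eq_zero_iff_mem.2 hx, map_zero]
  rw [h2]
  exact h

end Semisimple

/-! ### The generators of the Temperley-Lieb algebra -/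

section Generators

variable (n : ℕ) (δ : ℂ)

/-- The generators of `TL_n(δ)` indexed by natural numbers. -/
def genNat (i : ℕ) : TL n δ := if h : i < n - 1 then gen n δ ⟨i, h⟩ else 0

lemma genNat_of_lt {i : ℕ} (h : i < n - 1) : genNat n δ i = gen n δ ⟨i, h⟩ := dif_pos h

lemma isTLFamily_genNat : IsTLFamily δ (n - 1) (genNat n δ) where
  sq i hi := by
    rw [genNat_of_lt n δ hi, gen, ← map_mul, ← map_smul]
    exact RingQuot.mkAlgHom_rel ℂ (Rel.sq _)
  up i hi := by
    rw [genNat_of_lt n δ hi, genNat_of_lt n δ (by omega : i < n - 1), gen, gen, ← map_mul, ← map_mul]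
    exact RingQuot.mkAlgHom_rel ℂ (Rel.adj _ _ (Or.inl rfl))
  down i hi := by
    rw [genNat_of_lt n δ hi, genNat_of_lt n δ (by omega : i < n - 1), gen, gen, ← map_mul, ← map_mul]
    exact RingQuot.mkAlgHom_rel ℂ (Rel.adj _ _ (Or.inr rfl))
  comm i j hij hj := by
    rw [genNat_of_lt n δ hj, genNat_of_lt n δ (by omega : i < n - 1), gen, gen, Commute, SemiconjBy,
      ← map_mul, ← map_mul]
    exact RingQuot.mkAlgHom_rel ℂ (Rel.comm _ _ (Or.inl hij))

lemma adjoin_genNat : Algebra.adjoin ℂ (genNat n δ '' Set.Iio (n - 1)) = ⊤ := by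
  have h : genNat n δ '' Set.Iio (n - 1) =
      RingQuot.mkAlgHom ℂ (Rel n δ) '' Set.range (FreeAlgebra.ι ℂ) := by
    ext x
    constructor
    · rintro ⟨i, hi, rfl⟩
      exact ⟨_, ⟨⟨i, hi⟩, rfl⟩, (genNat_of_lt n δ hi).symm⟩
    · rintro ⟨_, ⟨i, rfl⟩, rfl⟩
      exact ⟨i, i.2, genNat_of_lt n δ i.2⟩
  rw [h, ← AlgHom.map_adjoin, FreeAlgebra.adjoin_range_ι, Algebra.map_top,
    AlgHom.range_eq_top]
  exact RingQuot.mkAlgHom_surjective ℂ _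

instance finiteDimensional_TL : FiniteDimensional ℂ (TL n δ) :=
  (isTLFamily_genNat n δ).finite (adjoin_genNat n δ)

lemma oddEvenWord_eq (m : ℕ) :
    oddEvenWord m δ = evenProd (genNat (2 * m) δ) m * oddProd (genNat (2 * m) δ) (m - 1) := by
  rw [oddEvenWord, evenProd, oddProd]
  congr 4
  · funext i; rw [genNat_of_lt]
  · funext i; rw [genNat_of_lt]

lemma trace_oddEvenWord {m : ℕ} (hm : 0 < m) {t : TL (2 * m) δ →ₗ[ℂ] ℂ}
    (ht : t ∈ traceSpace (TL (2 * m) δ)) :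
    t (oddEvenWord m δ) =
      t (word (genNat (2 * m) δ) (Finset.range (2 * m)) 0 (2 * m - 1)) := by
  obtain ⟨k, rfl⟩ : ∃ k, m = k + 1 := ⟨m - 1, by omega⟩
  rw [oddEvenWord_eq]
  exact (isTLFamily_genNat _ δ).trace_evenProd_mul_oddProd ht
    (fun i hi => by simp; omega) k (by omega)

lemma oddEvenWord_mul_self {m : ℕ} (hm : 0 < m) :
    oddEvenWord m δ * oddEvenWord m δ = δ • oddEvenWord m δ := by
  obtain ⟨k, rfl⟩ : ∃ k, m = k + 1 := ⟨m - 1, by omega⟩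
  rw [oddEvenWord_eq, ← mul_assoc, Nat.add_sub_cancel,
    (isTLFamily_genNat _ δ).evenProd_mul_oddProd_mul_evenProd k (by omega), smul_mul_assoc]

end Generators

lemma map_word {A B F : Type*} [Ring A] [Ring B] [FunLike F A B] [RingHomClass F A B] (f : F)
    {e : ℕ → A} {e' : ℕ → B} {S : Finset ℕ} {k : ℕ} (h : ∀ i < k, f (e i) = e' i) :
    f (word e S 0 k) = word e' S 0 k := by
  induction k with
  | zero => simp
  | succ k ih =>
    rw [word_succ, word_succ, map_mul, ih fun i hi => h i (by omega), zero_add]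
    split_ifs
    · rw [h k (by omega)]
    · rw [map_one]

/-! ### Spin chain over a general coefficient ring -/

section SpinRep

variable {R : Type*} [CommRing R] [Algebra ℂ R] (q q' z z' : R) (n : ℕ)

/-- The action of the free algebra on the spin chain. -/
def freeSpin : FreeAlgebra ℂ (Fin (n - 1)) →ₐ[ℂ]
    Matrix (Fin (n - 1 + 1) → Bool) (Fin (n - 1 + 1) → Bool) R :=
  FreeAlgebra.lift ℂ fun i => chainMatrix q q' (n - 1) i

variable {q q' z z' n}

lemma freeSpin_ι (i : Fin (n - 1)) :
    freeSpin q q' n (FreeAlgebra.ι ℂ i) = chainMatrix q q' (n - 1) i :=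
  FreeAlgebra.lift_ι_apply _ _

lemma commute_freeSpin (x : FreeAlgebra ℂ (Fin (n - 1))) : Commute (freeSpin q q' n x)
    (Matrix.diagonal fun σ : Fin (n - 1 + 1) → Bool => ∏ k, siteWeight z z' (σ k)) := by
  induction x using FreeAlgebra.induction with
  | grade0 c => rw [AlgHom.commutes]; exact Algebra.commute_algebraMap_left _ _
  | grade1 i =>
    rw [freeSpin_ι]
    exact commute_spinMatrix_weight (ofNat_ne (by omega) (by omega) (by omega))
  | mul x y hx hy => rw [map_mul]; exact hx.mul_left hy
  | add x y hx hy => rw [map_add]; exact hx.add_left hy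

lemma twistedTrace_freeSpin_comm (x y : FreeAlgebra ℂ (Fin (n - 1))) :
    twistedTrace z z' (freeSpin q q' n (x * y)) = twistedTrace z z' (freeSpin q q' n (y * x)) := by
  simp only [twistedTrace, LinearMap.coe_mk, AddHom.coe_mk, map_mul]
  rw [mul_assoc, (commute_freeSpin y).eq, ← mul_assoc, Matrix.trace_mul_comm, mul_assoc]

/-- Base change, applied to the map from dual numbers to ℂ that sets ε = 0. The free algebra is used
because over the dual numbers the loop parameter is no longer 0. -/
lemma map_twistedTrace_freeSpin {R' : Type*} [CommRing R'] [Algebra ℂ R'] (φ : R →ₐ[ℂ] R')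
    (x : FreeAlgebra ℂ (Fin (n - 1))) : φ (twistedTrace z z' (freeSpin q q' n x)) =
      twistedTrace (φ z) (φ z') (freeSpin (φ q) (φ q') n x) := by
  have h : φ.mapMatrix.comp (freeSpin q q' n) = freeSpin (φ q) (φ q') n := by
    refine FreeAlgebra.hom_ext (funext fun i => ?_)
    simp only [Function.comp_apply, AlgHom.comp_apply, freeSpin_ι]
    ext σ τ
    simp only [AlgHom.mapMatrix_apply, Matrix.map_apply, chainMatrix, spinMatrix_apply, cupCoeff]
    simp only [map_mul, map_add, apply_ite φ, map_zero, map_one]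
  rw [← h, twistedTrace_apply, twistedTrace_apply, map_sum]
  refine Finset.sum_congr rfl fun σ _ => ?_
  rw [map_mul, map_prod]
  simp [siteWeight, apply_ite φ]

lemma freeSpin_adj (hq : q * q' = 1) (i j : Fin (n - 1))
    (h : i.val + 1 = j.val ∨ j.val + 1 = i.val) :
    freeSpin q q' n (FreeAlgebra.ι ℂ i * FreeAlgebra.ι ℂ j * FreeAlgebra.ι ℂ i) =
      freeSpin q q' n (FreeAlgebra.ι ℂ i) := by
  simp only [map_mul, freeSpin_ι]
  rcases h with h | h
  · rw [← h]
    exact (chainMatrix_adj hq (by omega)).1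
  · rw [← h]
    exact (chainMatrix_adj hq (by omega)).2

lemma freeSpin_comm (i j : Fin (n - 1)) (h : i.val + 1 < j.val ∨ j.val + 1 < i.val) :
    freeSpin q q' n (FreeAlgebra.ι ℂ i * FreeAlgebra.ι ℂ j) =
      freeSpin q q' n (FreeAlgebra.ι ℂ j * FreeAlgebra.ι ℂ i) := by
  simp only [map_mul, freeSpin_ι]
  rcases h with h | h
  · exact chainMatrix_comm h j.2
  · exact (chainMatrix_comm h i.2).symm

lemma freeSpin_sq (i : Fin (n - 1)) :
    freeSpin q q' n (FreeAlgebra.ι ℂ i * FreeAlgebra.ι ℂ i) =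
      (q + q') • freeSpin q q' n (FreeAlgebra.ι ℂ i) := by
  rw [map_mul, freeSpin_ι]
  exact chainMatrix_sq i.2

/-- The words of the free algebra that correspond to ordered words in the generators. -/
def freeGen (n i : ℕ) : FreeAlgebra ℂ (Fin (n - 1)) :=
  if h : i < n - 1 then FreeAlgebra.ι ℂ ⟨i, h⟩ else 0

lemma freeSpin_word (S : Finset ℕ) :
    freeSpin q q' n (word (freeGen n) S 0 (n - 1)) = word (chainMatrix q q' (n - 1)) S 0 (n - 1) :=
  map_word _ fun i hi => by rw [freeGen, dif_pos hi, freeSpin_ι]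

lemma mkAlgHom_word (δ : ℂ) (S : Finset ℕ) :
    RingQuot.mkAlgHom ℂ (Rel n δ) (word (freeGen n) S 0 (n - 1)) =
      word (genNat n δ) S 0 (n - 1) :=
  map_word _ fun i hi => by rw [freeGen, dif_pos hi, genNat_of_lt n δ hi, gen]

end SpinRep

/-! ### Spin traces and test words -/

section SpinTrace

variable {q q' δ : ℂ} {n : ℕ}

/-- The representation of `TL_n(q + q⁻¹)` on the spin chain. -/
def spinRep (n : ℕ) (hq : q * q' = 1) (hδ : δ = q + q') : TL n δ →ₐ[ℂ]
    Matrix (Fin (n - 1 + 1) → Bool) (Fin (n - 1 + 1) → Bool) ℂ :=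
  RingQuot.liftAlgHom ℂ ⟨freeSpin q q' n, fun x y h => by
    induction h with
    | sq i => rw [freeSpin_sq, map_smul, hδ]
    | adj i j h => exact freeSpin_adj hq i j h
    | comm i j h => exact freeSpin_comm i j h⟩

lemma spinRep_mkAlgHom (hq : q * q' = 1) (hδ : δ = q + q') (x : FreeAlgebra ℂ (Fin (n - 1))) :
    spinRep n hq hδ (RingQuot.mkAlgHom ℂ (Rel n δ) x) = freeSpin q q' n x :=
  RingQuot.liftAlgHom_mkAlgHom_apply _ _ _ _

/-- The twisted trace of the spin representation. -/
def spinTrace (n : ℕ) (hq : q * q' = 1) (hδ : δ = q + q') (z z' : ℂ) : TL n δ →ₗ[ℂ] ℂ :=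
  (twistedTrace z z').comp (spinRep n hq hδ).toLinearMap

lemma spinTrace_mkAlgHom (hq : q * q' = 1) (hδ : δ = q + q') (z z' : ℂ)
    (x : FreeAlgebra ℂ (Fin (n - 1))) :
    spinTrace n hq hδ z z' (RingQuot.mkAlgHom ℂ (Rel n δ) x) =
      twistedTrace z z' (freeSpin q q' n x) := by
  rw [← spinRep_mkAlgHom hq hδ]; rfl

lemma spinTrace_mem (hq : q * q' = 1) (hδ : δ = q + q') (z z' : ℂ) :
    spinTrace n hq hδ z z' ∈ traceSpace (TL n δ) := by
  intro x y
  obtain ⟨x, rfl⟩ := RingQuot.mkAlgHom_surjective ℂ (Rel n δ) x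
  obtain ⟨y, rfl⟩ := RingQuot.mkAlgHom_surjective ℂ (Rel n δ) y
  rw [← map_mul, ← map_mul, spinTrace_mkAlgHom, spinTrace_mkAlgHom]
  exact twistedTrace_freeSpin_comm x y

lemma isNilpotent_of_mem_jacobson {A : Type*} [Ring A] [IsArtinianRing A] {x : A}
    (hx : x ∈ Ring.jacobson A) : IsNilpotent x := by
  obtain ⟨k, hk⟩ := IsSemiprimaryRing.isNilpotent (R := A)
  exact ⟨k, by have := Ideal.pow_mem_pow hx k; rwa [hk] at this⟩

/-- A radical element acts nilpotently, and still does after multiplication by the weight, which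
commutes with the action; a nilpotent matrix has trace zero. -/
lemma spinTrace_mem_radicalTraces (hq : q * q' = 1) (hδ : δ = q + q') (z z' : ℂ) :
    spinTrace n hq hδ z z' ∈ radicalTraces (TL n δ) := by
  refine ⟨spinTrace_mem hq hδ z z', fun x hx => ?_⟩
  have : IsArtinianRing (TL n δ) := IsArtinianRing.of_finite ℂ _
  have h1 := (isNilpotent_of_mem_jacobson hx).map (spinRep n hq hδ)
  obtain ⟨x, rfl⟩ := RingQuot.mkAlgHom_surjective ℂ (Rel n δ) x
  rw [spinRep_mkAlgHom] at h1
  rw [spinTrace_mkAlgHom]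
  exact (Matrix.isNilpotent_trace_of_isNilpotent
    ((commute_freeSpin (z := z) (z' := z') x).isNilpotent_mul_right h1)).eq_zero

/-- The `j`-th test element, on which traces are compared. -/
def testWord (n : ℕ) (δ : ℂ) (j : ℕ) : TL n δ :=
  word (genNat n δ) (Finset.range (2 * j)) 0 (n - 1)

lemma trace_eq_zero_of_testWord {t : TL n δ →ₗ[ℂ] ℂ} (ht : t ∈ traceSpace (TL n δ))
    (h : ∀ j ≤ (n - 1 + 1) / 2, t (testWord n δ j) = 0) : t = 0 :=
  (isTLFamily_genNat n δ).trace_eq_zero_of_word (adjoin_genNat n δ) ht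
    ((isTLFamily_genNat n δ).trace_word_eq_zero ht h)

lemma spinTrace_testWord (hq : q * q' = 1) (hδ : δ = q + q') {z z' : ℂ} (hz : z * z' = 1) {j : ℕ}
    (hj : 2 * j ≤ n - 1 + 1) : spinTrace n hq hδ z z' (testWord n δ j) =
      (if 2 * j ≤ n - 1 then 1 else δ) * (z + z') ^ (n - 1 + 1 - 2 * j) := by
  rw [testWord, ← mkAlgHom_word, spinTrace_mkAlgHom, freeSpin_word]
  split_ifs with h
  · rw [twistedTrace_word_even hq hz h, one_mul]
  · rw [twistedTrace_word_full hq hz (by omega), hδ, show n - 1 + 1 - 2 * j = 0 by omega, pow_zero,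
      mul_one]

end SpinTrace

/-! ### The extra trace at δ = 0 -/

section ExtraTrace

variable {n : ℕ}

/-- The deformation to first order of the twisted trace on the free algebra. -/
def freeExtraTrace (q q' : DualNumber ℂ) (z : ℂ) (n : ℕ) : FreeAlgebra ℂ (Fin (n - 1)) →ₗ[ℂ] ℂ :=
  (TrivSqZeroExt.sndHom ℂ ℂ).comp
    (((twistedTrace (algebraMap ℂ (DualNumber ℂ) z) (algebraMap ℂ (DualNumber ℂ) (-z))).restrictScalars
      ℂ).comp (freeSpin q q' n).toLinearMap)

lemma freeExtraTrace_apply (q q' : DualNumber ℂ) (z : ℂ) (x : FreeAlgebra ℂ (Fin (n - 1))) :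
    freeExtraTrace q q' z n x = TrivSqZeroExt.snd (twistedTrace (algebraMap ℂ (DualNumber ℂ) z)
      (algebraMap ℂ (DualNumber ℂ) (-z)) (freeSpin q q' n x)) := rfl

/-- A functional on the free algebra that respects the defining relations in all contexts descends
to the quotient. -/
lemma exists_comp_mkAlgHom_eq {F : Type*} [Ring F] [Algebra ℂ F] (r : F → F → Prop)
    (s : F →ₗ[ℂ] ℂ) (h : ∀ x y, r x y → ∀ a b, s (a * x * b) = s (a * y * b)) :
    ∃ t : RingQuot r →ₗ[ℂ] ℂ, t.comp (RingQuot.mkAlgHom ℂ r).toLinearMap = s := by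
  -- Quantifying over two-sided contexts makes this a congruence, so the quotient by `r` maps onto
  -- the quotient by it.
  let c : RingCon F :=
    { r := fun x y => ∀ a b, s (a * x * b) = s (a * y * b)
      iseqv := ⟨fun _ _ _ => rfl, fun h a b => (h a b).symm, fun h h' a b => (h a b).trans (h' a b)⟩
      add' := fun {w x y z} h h' a b => by
        simp only [mul_add, add_mul, map_add, h a b, h' a b]
      mul' := fun {w x y z} h h' a b => by
        have h1 := h' (a * w) b
        have h2 := h a (z * b)
        simp only [mul_assoc] at h1 h2 ⊢
        rw [h1, h2] }
  let f : RingQuot r →ₐ[ℂ] c.Quotient := RingQuot.liftAlgHom ℂ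
    ⟨RingCon.mkₐ ℂ c, fun x y hxy => (RingCon.eq c).2 (h x y hxy)⟩
  refine exists_comp_eq_of_surjective (f := (RingQuot.mkAlgHom ℂ r).toLinearMap)
    (RingQuot.mkAlgHom_surjective ℂ r) s fun x hx => ?_
  have h1 : f (RingQuot.mkAlgHom ℂ r x) = RingCon.mkₐ ℂ c x :=
    RingQuot.liftAlgHom_mkAlgHom_apply _ _ _ _
  have h2 : RingCon.mkₐ ℂ c x = RingCon.mkₐ ℂ c 0 := by
    rw [← h1, map_zero]
    change f ((RingQuot.mkAlgHom ℂ r).toLinearMap x) = 0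
    rw [hx, map_zero]
  have h3 := (RingCon.eq c).1 h2 1 1
  simpa using h3

/-- For `δ = 0` and an even number of strands there is a trace that takes the value `1` on the
product of all generators. -/
lemma exists_extra_trace {q : ℂ} (hq : q * -q = 1) {j : ℕ} (hj : 2 * j = n - 1 + 1) :
    ∃ t ∈ traceSpace (TL n 0), t (testWord n 0 j) = 1 := by
  have hδ : (0 : ℂ) = q + -q := by ring
  have hI : Complex.I * -Complex.I = 1 := by simp
  -- The halves are chosen so that u u' = 1 still holds while u + u' = ε.
  let u : DualNumber ℂ := TrivSqZeroExt.inl q + TrivSqZeroExt.inr (1 / 2)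
  let u' : DualNumber ℂ := TrivSqZeroExt.inl (-q) + TrivSqZeroExt.inr (1 / 2)
  have hu : u * u' = 1 := by
    ext
    · simpa [u, u'] using hq
    · simp [u, u']; ring
  have huu : u + u' = TrivSqZeroExt.inr 1 := by
    ext
    · simp [u, u']
    · simp [u, u']; norm_num
  -- With z + z' = 0 every test value is a positive power of 0 or equals δ = 0, so the undeformed
  -- trace vanishes identically.
  have hzero : spinTrace n hq hδ Complex.I (-Complex.I) = 0 := by
    refine trace_eq_zero_of_testWord (spinTrace_mem hq hδ _ _) fun k hk => ?_
    rw [spinTrace_testWord hq hδ hI (by omega)]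
    split_ifs with h
    · rw [add_neg_cancel, zero_pow (by omega), mul_zero]
    · rw [zero_mul]
  have hfst : ∀ x, TrivSqZeroExt.fst (twistedTrace (algebraMap ℂ (DualNumber ℂ) Complex.I)
      (algebraMap ℂ (DualNumber ℂ) (-Complex.I)) (freeSpin u u' n x)) = 0 := by
    intro x
    have h := map_twistedTrace_freeSpin (n := n) (q := u) (q' := u')
      (z := algebraMap ℂ (DualNumber ℂ) Complex.I) (z' := algebraMap ℂ (DualNumber ℂ) (-Complex.I))
      (TrivSqZeroExt.fstHom ℂ ℂ ℂ) x
    rw [AlgHom.commutes, AlgHom.commutes] at h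
    have h1 : TrivSqZeroExt.fstHom ℂ ℂ ℂ u = q := by simp [u]
    have h2 : TrivSqZeroExt.fstHom ℂ ℂ ℂ u' = -q := by simp [u']
    rw [h1, h2] at h
    refine h.trans ?_
    have := spinTrace_mkAlgHom hq hδ Complex.I (-Complex.I) x
    rw [hzero] at this
    exact this.symm
  obtain ⟨t, ht⟩ := exists_comp_mkAlgHom_eq (Rel n 0) (freeExtraTrace u u' Complex.I n) (by
    intro x y hxy a b
    rw [freeExtraTrace_apply, freeExtraTrace_apply]
    have hsplit : ∀ y, freeSpin u u' n (a * y * b) =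
        freeSpin u u' n a * freeSpin u u' n y * freeSpin u u' n b := fun y => by
      rw [map_mul, map_mul]
    induction hxy with
    | sq i =>
      -- The deformed relation e² = εe contributes ε times a twisted trace whose constant part is
      -- zero.
      rw [hsplit, freeSpin_sq, mul_smul_comm, smul_mul_assoc, map_smul, huu, ← hsplit, zero_smul,
        mul_zero, zero_mul, map_zero, map_zero, TrivSqZeroExt.snd_zero, smul_eq_mul,
        TrivSqZeroExt.snd_mul, hfst]
      simp
    | adj i j h => rw [hsplit, hsplit, freeSpin_adj hu i j h]
    | comm i j h => rw [hsplit, hsplit, freeSpin_comm i j h])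
  have ht' : ∀ x, t (RingQuot.mkAlgHom ℂ (Rel n 0) x) = freeExtraTrace u u' Complex.I n x :=
    fun x => LinearMap.congr_fun ht x
  refine ⟨t, fun x y => ?_, ?_⟩
  · obtain ⟨x, rfl⟩ := RingQuot.mkAlgHom_surjective ℂ (Rel n 0) x
    obtain ⟨y, rfl⟩ := RingQuot.mkAlgHom_surjective ℂ (Rel n 0) y
    rw [← map_mul, ← map_mul, ht', ht', freeExtraTrace_apply, freeExtraTrace_apply,
      twistedTrace_freeSpin_comm]
  · rw [testWord, ← mkAlgHom_word, ht', freeExtraTrace_apply, freeSpin_word,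
      twistedTrace_word_full hu (by rw [← map_mul, hI, map_one]) hj, huu, TrivSqZeroExt.snd_inr]

end ExtraTrace

/-! ### Counting traces by their test values -/

section Main

/-- The values of a trace on the test elements. -/
def testMap (n : ℕ) (δ : ℂ) : (TL n δ →ₗ[ℂ] ℂ) →ₗ[ℂ] (Fin ((n - 1 + 1) / 2 + 1) → ℂ) where
  toFun t j := t (testWord n δ j)
  map_add' _ _ := rfl
  map_smul' _ _ := rfl

lemma testMap_apply (n : ℕ) (δ : ℂ) (t : TL n δ →ₗ[ℂ] ℂ) (j : Fin ((n - 1 + 1) / 2 + 1)) :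
    testMap n δ t j = t (testWord n δ j) := rfl

variable {n : ℕ} {q q' δ : ℂ}

lemma testMap_injOn {s t : TL n δ →ₗ[ℂ] ℂ} (hs : s ∈ traceSpace (TL n δ))
    (ht : t ∈ traceSpace (TL n δ)) (h : testMap n δ s = testMap n δ t) : s = t := by
  rw [← sub_eq_zero]
  refine trace_eq_zero_of_testWord (sub_mem hs ht) fun j hj => ?_
  have := congrFun h ⟨j, by omega⟩
  rw [testMap_apply, testMap_apply] at this
  rw [LinearMap.sub_apply, this, sub_self]

lemma exists_add_eq_mul_eq_one (y : ℂ) : ∃ z z' : ℂ, z + z' = y ∧ z * z' = 1 := by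
  obtain ⟨s, hs⟩ := IsAlgClosed.exists_pow_nat_eq (y ^ 2 - 4) (n := 2) (by norm_num)
  exact ⟨(y + s) / 2, (y - s) / 2, by ring, by linear_combination (-1 / 4) * hs⟩

/-- A linear relation between the values of all spin traces on the test elements is trivial. -/
lemma eq_zero_of_spinTrace_relation (hq : q * q' = 1) (hδ : δ = q + q')
    (c : Fin ((n - 1 + 1) / 2 + 1) → ℂ)
    (h : ∀ z z' : ℂ, z * z' = 1 → ∑ j, testMap n δ (spinTrace n hq hδ z z') j * c j = 0)
    (j : Fin ((n - 1 + 1) / 2 + 1)) : (if 2 * j.val ≤ n - 1 then 1 else δ) * c j = 0 := by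
  -- The relation is read as a polynomial in y = z + z'. Every y occurs with zz' = 1, and the
  -- exponents are distinct, so all coefficients vanish.
  let p : Polynomial ℂ := ∑ j : Fin ((n - 1 + 1) / 2 + 1),
    Polynomial.monomial (n - 1 + 1 - 2 * j.val) ((if 2 * j.val ≤ n - 1 then 1 else δ) * c j)
  have hp : p = 0 := by
    refine Polynomial.funext fun y => ?_
    obtain ⟨z, z', rfl, hz⟩ := exists_add_eq_mul_eq_one y
    rw [Polynomial.eval_zero, ← h z z' hz, Polynomial.eval_finsetSum]
    refine Finset.sum_congr rfl fun j _ => ?_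
    rw [Polynomial.eval_monomial, testMap_apply, spinTrace_testWord hq hδ hz (by omega)]
    ring
  have := congrArg (fun p => Polynomial.coeff p (n - 1 + 1 - 2 * j.val)) hp
  simp only [p, Polynomial.finsetSum_coeff, Polynomial.coeff_monomial, Polynomial.coeff_zero] at this
  rw [Finset.sum_eq_single j] at this
  · simpa using this
  · intro k _ hk
    refine if_neg fun h => hk (Fin.ext ?_)
    omega
  · simp

lemma submodule_eq_top_of_forall {m : ℕ} (W : Submodule ℂ (Fin m → ℂ))
    (h : ∀ c : Fin m → ℂ, (∀ w ∈ W, ∑ j, w j * c j = 0) → c = 0) : W = ⊤ := by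
  by_contra hW
  obtain ⟨f, hf, hle⟩ := W.exists_le_ker_of_lt_top (lt_top_iff_ne_top.2 hW)
  have hfw : ∀ w, f w = ∑ j, w j * f (Pi.single j 1) := fun w => by
    conv_lhs => rw [pi_eq_sum_univ' w]
    simp
  refine hf (LinearMap.ext fun w => ?_)
  rw [hfw, LinearMap.zero_apply]
  have := h (fun j => f (Pi.single j 1)) fun w hw => by
    rw [← hfw]; exact hle hw
  exact Finset.sum_eq_zero fun j _ => by rw [congrFun this j]; simp

lemma map_testMap_radicalTraces (hq : q * q' = 1) (hδ : δ = q + q') (h : δ ≠ 0 ∨ n ≤ 1 ∨ Odd n) :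
    (radicalTraces (TL n δ)).map (testMap n δ) = ⊤ := by
  refine submodule_eq_top_of_forall _ fun c hc => funext fun j => ?_
  have := eq_zero_of_spinTrace_relation hq hδ c (fun z z' _ => hc _
    ⟨_, spinTrace_mem_radicalTraces hq hδ z z', rfl⟩) j
  refine (mul_eq_zero.1 this).resolve_left ?_
  split_ifs with hj
  · exact one_ne_zero
  · rcases h with h | h | ⟨k, rfl⟩
    · exact h
    · omega
    · omega

/-- In the exceptional case the spin traces control every coordinate except the last, and the extra
trace supplies that one. -/
lemma map_testMap_traceSpace (hq : q * q' = 1) (hδ : δ = q + q') :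
    (traceSpace (TL n δ)).map (testMap n δ) = ⊤ := by
  by_cases h : δ ≠ 0 ∨ n ≤ 1 ∨ Odd n
  · exact top_le_iff.1 ((map_testMap_radicalTraces hq hδ h).ge.trans
      (Submodule.map_mono fun t ht => ht.1))
  · push Not at h
    obtain ⟨rfl, hn, hn'⟩ := h
    rw [Nat.not_odd_iff_even] at hn'
    obtain ⟨k, rfl⟩ := hn'
    have hq' : q' = -q := by linear_combination -hδ
    obtain ⟨t, ht, ht1⟩ := exists_extra_trace (n := k + k) (hq' ▸ hq) (j := k) (by omega)
    refine submodule_eq_top_of_forall _ fun c hc => ?_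
    have hc1 := eq_zero_of_spinTrace_relation hq hδ c (fun z z' _ => hc _
      ⟨_, spinTrace_mem hq hδ z z', rfl⟩)
    have hc2 : ∀ j, j ≠ (⟨k, by omega⟩ : Fin ((k + k - 1 + 1) / 2 + 1)) → c j = 0 := by
      intro j hj
      have hjk : j.val ≠ k := fun h => hj (Fin.ext h)
      have := hc1 j
      rwa [if_pos (by omega), one_mul] at this
    have hc3 := hc _ ⟨t, ht, rfl⟩
    rw [Finset.sum_eq_single ⟨k, by omega⟩ (fun j _ hj => by rw [hc2 j hj, mul_zero]) (by simp),
      testMap_apply, ht1, one_mul] at hc3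
    funext j
    by_cases hj : j = ⟨k, by omega⟩
    · rw [hj, hc3]; rfl
    · exact hc2 j hj

lemma finrank_traceSpace (hq : q * q' = 1) (hδ : δ = q + q') :
    Module.finrank ℂ (traceSpace (TL n δ)) = n / 2 + 1 := by
  have hbij : Function.Bijective ((testMap n δ).domRestrict (traceSpace (TL n δ))) := by
    refine ⟨fun s t h => Subtype.ext (testMap_injOn s.2 t.2 h), fun c => ?_⟩
    have : c ∈ (traceSpace (TL n δ)).map (testMap n δ) := by
      rw [map_testMap_traceSpace hq hδ]; trivial
    obtain ⟨t, ht, rfl⟩ := this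
    exact ⟨⟨t, ht⟩, rfl⟩
  rw [(LinearEquiv.ofBijective _ hbij).finrank_eq, Module.finrank_fin_fun]
  -- For n = 0 the truncated subtraction gives a chain with one site, and the count (n - 1 + 1) / 2
  -- is still 0.
  omega

/-- Traces that vanish on the radical already attain all test values, and the test values determine
a trace. -/
lemma radicalTraces_eq_traceSpace (hq : q * q' = 1) (hδ : δ = q + q') (h : δ ≠ 0 ∨ Odd n) :
    radicalTraces (TL n δ) = traceSpace (TL n δ) := by
  refine le_antisymm (fun t ht => ht.1) fun t ht => ?_
  have h1 : testMap n δ t ∈ (radicalTraces (TL n δ)).map (testMap n δ) := by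
    rw [map_testMap_radicalTraces hq hδ (h.imp_right Or.inr)]; trivial
  obtain ⟨s, hs, hst⟩ := h1
  exact testMap_injOn hs.1 ht hst ▸ hs

variable {m : ℕ}

/-- At `δ = 0` the traces that vanish on the radical vanish on the nilpotent test word. -/
lemma radicalTraces_oddEvenWord (hm : 0 < m) {t : TL (2 * m) 0 →ₗ[ℂ] ℂ}
    (ht : t ∈ radicalTraces (TL (2 * m) 0)) : t (oddEvenWord m 0) = 0 := by
  rw [← (isBasisOf_semisimpleMatrixTraces (TL (2 * m) 0)).2] at ht
  induction ht using Submodule.span_induction with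
  | mem t ht =>
    obtain ⟨_, ⟨d, ρ, _, _, rfl⟩, rfl⟩ := ht
    have h1 : IsNilpotent (oddEvenWord m 0) :=
      ⟨2, by rw [pow_two, oddEvenWord_mul_self 0 hm, zero_smul]⟩
    exact (Matrix.isNilpotent_trace_of_isNilpotent
      ((h1.map (Ideal.Quotient.mkₐ ℂ (Ring.jacobson (TL (2 * m) 0)))).map ρ)).eq_zero
  | zero => rfl
  | add s t _ _ hs ht => rw [LinearMap.add_apply, hs, ht, add_zero]
  | smul c t _ ht => rw [LinearMap.smul_apply, ht, smul_zero]

lemma testWord_of_mem_radicalTraces (hm : 0 < m) {t : TL (2 * m) 0 →ₗ[ℂ] ℂ}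
    (ht : t ∈ radicalTraces (TL (2 * m) 0)) : t (testWord (2 * m) 0 m) = 0 := by
  rw [testWord, ← trace_oddEvenWord 0 hm ht.1, radicalTraces_oddEvenWord hm ht]

/-- At `δ = 0`, `n = 2m`, the values on the first `m` test words identify the traces that vanish
on the radical with `ℂ ^ m`. -/
lemma exists_unique_radicalTrace (hm : 0 < m) (hq : q * q' = 1) (hδ : 0 = q + q') (c : Fin m → ℂ) :
    ∃! t, t ∈ radicalTraces (TL (2 * m) 0) ∧ ∀ j : Fin m, t (testWord (2 * m) 0 j) = c j := by
  let f : (TL (2 * m) 0 →ₗ[ℂ] ℂ) →ₗ[ℂ] (Fin m → ℂ) :=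
    (LinearMap.funLeft ℂ ℂ fun j : Fin m => (⟨j, by omega⟩ : Fin ((2 * m - 1 + 1) / 2 + 1))).comp
      (testMap (2 * m) 0)
  have hf : ∀ t j, f t j = t (testWord (2 * m) 0 j) := fun t j => rfl
  have htop : (radicalTraces (TL (2 * m) 0)).map f = ⊤ := by
    refine submodule_eq_top_of_forall _ fun c hc => ?_
    -- Extension by zero to the last coordinate, about which the spin traces say nothing when δ = 0.
    let c' : Fin ((2 * m - 1 + 1) / 2 + 1) → ℂ := fun j => if h : j.val < m then c ⟨j, h⟩ else 0
    have h1 := eq_zero_of_spinTrace_relation (n := 2 * m) hq hδ c' fun z z' _ => by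
      refine Eq.trans (Eq.symm ?_) (hc _ ⟨_, spinTrace_mem_radicalTraces hq hδ z z', rfl⟩)
      refine Finset.sum_of_injOn (fun j : Fin m => (⟨j, by omega⟩ : Fin ((2 * m - 1 + 1) / 2 + 1)))
        (fun i _ j _ h => Fin.ext (Fin.mk.inj h)) (by simp) (fun j _ hj => ?_) fun j _ => ?_
      · have : ¬ j.val < m := fun h => hj ⟨⟨j, h⟩, by simp, rfl⟩
        simp only [c', dif_neg this, mul_zero]
      · simp only [c', hf, testMap_apply, dif_pos j.2]
    funext j
    have := h1 ⟨j, by omega⟩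
    simp only [c', dif_pos j.2] at this
    rwa [if_pos (by omega), one_mul] at this
  have hc : c ∈ (radicalTraces (TL (2 * m) 0)).map f := by rw [htop]; trivial
  obtain ⟨t, ht, rfl⟩ := hc
  refine ⟨t, ⟨ht, fun j => rfl⟩, fun s ⟨hs, hst⟩ => testMap_injOn hs.1 ht.1 (funext fun j => ?_)⟩
  rw [testMap_apply, testMap_apply]
  by_cases hj : j.val < m
  · exact hst ⟨j, hj⟩
  · have : j.val = m := by omega
    rw [this, testWord_of_mem_radicalTraces hm hs, testWord_of_mem_radicalTraces hm ht]

lemma finrank_radicalTraces (hm : 0 < m) (hq : q * q' = 1) (hδ : 0 = q + q') :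
    Module.finrank ℂ (radicalTraces (TL (2 * m) 0)) = m := by
  let f : radicalTraces (TL (2 * m) 0) →ₗ[ℂ] (Fin m → ℂ) :=
    { toFun := fun t j => t.1 (testWord (2 * m) 0 j)
      map_add' := fun _ _ => rfl
      map_smul' := fun _ _ => rfl }
  have hbij : Function.Bijective f := by
    refine ⟨fun s t hst => ?_, fun c => ?_⟩
    · exact Subtype.ext ((exists_unique_radicalTrace hm hq hδ (f t)).unique
        ⟨s.2, congrFun hst⟩ ⟨t.2, fun j => rfl⟩)
    · obtain ⟨t, ⟨ht, htc⟩, -⟩ := exists_unique_radicalTrace hm hq hδ c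
      exact ⟨⟨t, ht⟩, funext htc⟩
  rw [(LinearEquiv.ofBijective f hbij).finrank_eq, Module.finrank_fin_fun]

/-- Some trace that vanishes on the radical has the same first m test values; on the last test word
both vanish, so the two coincide. -/
lemma mem_radicalTraces_of_oddEvenWord (hm : 0 < m) (hq : q * q' = 1) (hδ : 0 = q + q')
    {t : TL (2 * m) 0 →ₗ[ℂ] ℂ} (ht : t ∈ traceSpace (TL (2 * m) 0))
    (h : t (oddEvenWord m 0) = 0) : t ∈ radicalTraces (TL (2 * m) 0) := by
  obtain ⟨s, ⟨hs, hst⟩, -⟩ := exists_unique_radicalTrace hm hq hδ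
    fun j => t (testWord (2 * m) 0 j)
  have : s = t := by
    refine testMap_injOn hs.1 ht (funext fun j => ?_)
    rw [testMap_apply, testMap_apply]
    by_cases hj : j.val < m
    · exact hst ⟨j, hj⟩
    · have : j.val = m := by omega
      rw [this, testWord_of_mem_radicalTraces hm hs, testWord, ← trace_oddEvenWord 0 hm ht, h]
  exact this ▸ hs

lemma IsBasisOf.ncard_eq {V : Type*} [AddCommGroup V] [Module ℂ V] {S : Set V} {W : Submodule ℂ V}
    (h : IsBasisOf S W) : S.ncard = Module.finrank ℂ W := by
  have hb := Module.finrank_eq_nat_card_basis (Module.Basis.span h.1)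
  have hW : Submodule.span ℂ (Set.range fun x : S => id (x : V)) = W := by
    rw [← h.2]
    exact congrArg _ Subtype.range_coe
  rw [hW] at hb
  exact hb.symm

end Main

end TemperleyLieb

theorem mainTheorem12 (q : ℂ) (l : ℕ) (hl : 0 < l) (hq : q ^ (2 * l) = 1)
    (δ : ℂ) (hδ : δ = q + q⁻¹) :
    (∀ n : ℕ,
      Module.finrank ℂ (TemperleyLieb.traceSpace (TemperleyLieb.TL n δ)) = n / 2 + 1) ∧
    (∀ n : ℕ, (δ ≠ 0 ∨ Odd n) →
      (∀ t ∈ TemperleyLieb.traceSpace (TemperleyLieb.TL n δ),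
        ∀ x ∈ Ring.jacobson (TemperleyLieb.TL n δ), t x = 0) ∧
      TemperleyLieb.IsBasisOf
        (TemperleyLieb.semisimpleMatrixTraces (TemperleyLieb.TL n δ))
        (TemperleyLieb.traceSpace (TemperleyLieb.TL n δ))) ∧
    (δ = 0 → ∀ m : ℕ, 0 < m →
      (TemperleyLieb.semisimpleMatrixTraces (TemperleyLieb.TL (2 * m) δ)).ncard = m ∧
      (∃ t₀ ∈ TemperleyLieb.traceSpace (TemperleyLieb.TL (2 * m) δ),
        t₀ (TemperleyLieb.oddEvenWord m δ) = 1) ∧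
      (∀ t₀ ∈ TemperleyLieb.traceSpace (TemperleyLieb.TL (2 * m) δ),
        t₀ (TemperleyLieb.oddEvenWord m δ) = 1 →
        TemperleyLieb.IsBasisOf
          (insert t₀ (TemperleyLieb.semisimpleMatrixTraces (TemperleyLieb.TL (2 * m) δ)))
          (TemperleyLieb.traceSpace (TemperleyLieb.TL (2 * m) δ)))) := by
  open TemperleyLieb in
  have hq0 : q ≠ 0 := by
    rintro rfl
    rw [zero_pow (by omega)] at hq
    exact zero_ne_one hq
  have hqq : q * q⁻¹ = 1 := mul_inv_cancel₀ hq0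
  refine ⟨fun n => finrank_traceSpace hqq hδ, fun n hn => ?_, ?_⟩
  · have h := radicalTraces_eq_traceSpace hqq hδ hn
    refine ⟨fun t ht => ?_, ?_⟩
    · rw [← h] at ht
      exact ht.2
    · rw [← h]
      exact isBasisOf_semisimpleMatrixTraces _
  · rintro rfl m hm
    have hb := isBasisOf_semisimpleMatrixTraces (TL (2 * m) 0)
    have hrank := finrank_radicalTraces hm hqq hδ
    refine ⟨hb.ncard_eq.trans hrank, ?_, fun t₀ ht₀ h1 => ⟨?_, ?_⟩⟩
    · have hq' : q⁻¹ = -q := by linear_combination -hδ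
      obtain ⟨t, ht, ht1⟩ := exists_extra_trace (n := 2 * m) (hq' ▸ hqq) (j := m) (by omega)
      exact ⟨t, ht, by rw [trace_oddEvenWord 0 hm ht]; exact ht1⟩
    · refine hb.1.id_insert fun hmem => ?_
      rw [hb.2] at hmem
      rw [radicalTraces_oddEvenWord hm hmem] at h1
      exact zero_ne_one h1
    · refine le_antisymm (Submodule.span_le.2 ?_) fun t ht => ?_
      · rintro t (rfl | ht)
        · exact ht₀
        · have : t ∈ radicalTraces (TL (2 * m) 0) := hb.2 ▸ Submodule.subset_span ht
          exact this.1
      · rw [Submodule.mem_span_insert, hb.2]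
        -- Subtracting this multiple of `t₀` kills the odd-even word, so the difference is a
        -- combination of matrix traces.
        refine ⟨t (oddEvenWord m 0), t - t (oddEvenWord m 0) • t₀,
          mem_radicalTraces_of_oddEvenWord hm hqq hδ
            (sub_mem ht (Submodule.smul_mem _ _ ht₀)) ?_, by abel⟩
        simp [h1]
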